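/- Let $n\ge 1$ and let $I,J\subset\mathbb R^n$ be Lebesgue measurable with $0<|I|,|J|<\infty$. On $L^2(\mathbb R^n)$ let $P_If=\chi_I f$ and $Q_Jf=(\chi_J\hat f)^{\vee}$, where $\hat f(\xi)=\int f(x)e^{-2\pi i\langle x,\xi\rangle}dx$ is the Fourier–Plancherel transform. Let $R(\cdot)$, $N(\cdot)$ denote range and nullspace. The generic part $\mathcal H_0$ of $(P_I,Q_J)$ is the orthogonal complement of the sum of $R(P_I)\cap R(Q_J)$, $N(P_I)\cap N(Q_J)$, $R(P_I)\cap N(Q_J)$ and $N(P_I)\cap R(Q_J)$. A Halmos decomposition consists of a Hilbert space $\mathcal L$, a unitary $\mathcal H_0\cong\mathcal L\times\mathcal L$ and a selfadjoint operator $X$ on $\mathcal L$ with $0\le X\le\pi/2$ and $N(X)=\{0\}$, such that on $\mathcal H_0$, with $C=\cos X$ and $S=\sin X$, $$P_I=\begin{pmatrix}1&0\\0&0\end{pmatrix},\qquad Q_J=\begin{pmatrix}C^2&CS\\CS&S^2\end{pmatrix}.$$ A geodesic exponent of $(P_I,Q_J)$ is a selfadjoint operator $X_{I,J}$ on $L^2(\mathbb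 R^n)$ with $\|X_{I,J}\|=\pi/2$, co-diagonal with respect to $P_I$ and to $Q_J$ (it maps the range of each of these projections into its nullspace and vice versa), and with $e^{iX_{I,J}}P_Ie^{-iX_{I,J}}=Q_J$. All Hilbert–Schmidt norms below take values in $[0,\infty]$, and "the eigenvalues of $T$ counted with multiplicity" means the eigenvalues along any Hilbert basis of eigenvectors of $T$; part of the claim is that such a basis exists. 1. A Halmos decomposition exists. For every Halmos decomposition, with $X^0=\begin{pmatrix}0&-iX\\iX&0\end{pmatrix}$, $$|I|^{1/2}|J|^{1/2}=\|\cos X\|_{HS}=\tfrac1{\sqrt2}\|\cos X^0\|_{HS},$$ $$|I||J|=\sum_n\cos^2\gamma_n=\sum_k\tfrac12\cos^2\mu_k,$$ where $(\gamma_n)$ are the eigenvalues of $X$ and $(\mu_k)$ those of $X^0$, both counted with multiplicity. 2. If $R(P_I)\cap N(Q_J)=R(Q_J)\cap N(P_I)=\{0\}$, then there is exactly one geodesic exponent $X_{I,J}$. 3. For every geodesic exponent $X_{I,J}$, with $X_{I,J}^0$ its restriction to $N(X_{I,J})^\perp$, $$|I|^{1/2}|J|^{1/2}=\tfrac1{\sqrt2}\|\cos(X_{I,J}^0)\|_{HS}=\Big(\sum_k\tfrac12\cos^2\mu_k\Big)^{1/2},$$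 where $(\mu_k)$ are the eigenvalues of $X_{I,J}^0$ counted with multiplicity. -/

import Mathlib

open MeasureTheory FourierTransform
open scoped ENNReal

noncomputable section

/-! ### The Hilbert-Schmidt norm -/

section HilbertSchmidt

variable {H : Type*} [NormedAddCommGroup H] [InnerProductSpace ℂ H] [CompleteSpace H]

/-- The Hilbert-Schmidt norm `(∑ i, ‖T eᵢ‖²)^(1/2) ∈ [0, ∞]` of a bounded operator, computed in
some Hilbert basis `e`. It is finite exactly when `T` is a Hilbert-Schmidt operator, and
`hsNorm_eq` shows that it does not depend on the basis. -/
def hsNorm (T : H →L[ℂ] H) : ℝ≥0∞ :=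
  (∑' i, ‖T ((exists_hilbertBasis ℂ H).choose_spec.choose i)‖ₑ ^ 2) ^ (1 / 2 : ℝ)

theorem HilbertBasis.tsum_enorm_inner_sq {ι : Type*} (b : HilbertBasis ι ℂ H) (x : H) :
    ∑' i, ‖inner ℂ (b i) x‖ₑ ^ 2 = ‖x‖ₑ ^ 2 := by
  have h := b.hasSum_inner_mul_inner x x
  have h2 : HasSum (fun i => ‖inner ℂ (b i) x‖ ^ 2) (‖x‖ ^ 2) := by
    have h3 := Complex.hasSum_re h
    have h4 : (inner ℂ x x : ℂ).re = ‖x‖ ^ 2 := by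
      rw [inner_self_eq_norm_sq_to_K]; norm_cast
    rw [h4] at h3
    refine h3.congr_fun ?_
    intro i
    rw [← inner_conj_symm x (b i), ← Complex.normSq_eq_conj_mul_self, Complex.ofReal_re,
      Complex.normSq_eq_norm_sq]
  have h5 : ∀ i, ‖inner ℂ (b i) x‖ₑ ^ 2 = ENNReal.ofReal (‖inner ℂ (b i) x‖ ^ 2) := by
    intro i
    rw [ENNReal.ofReal_pow (norm_nonneg _), ofReal_norm]
  simp_rw [h5]
  rw [← ENNReal.ofReal_tsum_of_nonneg (fun i => by positivity) h2.summable, h2.tsum_eq,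
    ENNReal.ofReal_pow (norm_nonneg _), ofReal_norm]

theorem tsum_enorm_sq_adjoint {ι κ : Type*} (b : HilbertBasis ι ℂ H) (c : HilbertBasis κ ℂ H)
    (T : H →L[ℂ] H) :
    ∑' i, ‖T (b i)‖ₑ ^ 2 = ∑' j, ‖ContinuousLinearMap.adjoint T (c j)‖ₑ ^ 2 := by
  simp_rw [← fun i => c.tsum_enorm_inner_sq (T (b i)),
    ← fun j => b.tsum_enorm_inner_sq (ContinuousLinearMap.adjoint T (c j))]
  rw [ENNReal.tsum_comm]
  refine tsum_congr fun j => tsum_congr fun i => ?_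
  rw [ContinuousLinearMap.adjoint_inner_right, ← inner_conj_symm, RCLike.enorm_conj]

theorem hsNorm_eq {ι : Type*} (b : HilbertBasis ι ℂ H) (T : H →L[ℂ] H) :
    hsNorm T = (∑' i, ‖T (b i)‖ₑ ^ 2) ^ (1 / 2 : ℝ) := by
  rw [hsNorm, tsum_enorm_sq_adjoint _ b, tsum_enorm_sq_adjoint b b,
    ContinuousLinearMap.adjoint_adjoint]

/-- The cosine of a bounded selfadjoint operator. -/
def opCos (X : H →L[ℂ] H) : H →L[ℂ] H := cfc Real.cos X

/-- The sine of a bounded selfadjoint operator. -/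
def opSin (X : H →L[ℂ] H) : H →L[ℂ] H := cfc Real.sin X

/-- `b` is a Hilbert basis of eigenvectors of `T`, with (real) eigenvalues `γ`; thus `γ` lists the
eigenvalues of `T`, each repeated according to its multiplicity. -/
def IsEigenbasis {ι : Type*} (T : H →L[ℂ] H) (b : HilbertBasis ι ℂ H) (γ : ι → ℝ) : Prop :=
  ∀ i, T (b i) = (γ i : ℂ) • b i

/-- `T` is diagonalizable in a Hilbert basis and, for every enumeration `γ` of its eigenvalues
with multiplicity, `∑ i, g (γ i) = s`. -/
def EigenvalueSumEq (T : H →L[ℂ] H) (g : ℝ → ℝ) (s : ℝ≥0∞) : Prop :=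
  (∃ (ι : Type) (b : HilbertBasis ι ℂ H) (γ : ι → ℝ), IsEigenbasis T b γ) ∧
  ∀ (ι : Type) (b : HilbertBasis ι ℂ H) (γ : ι → ℝ), IsEigenbasis T b γ →
    ∑' i, ENNReal.ofReal (g (γ i)) = s

/-- The restriction of a selfadjoint operator `Y` to the invariant subspace `N(Y)ᗮ`. -/
def restrictKerPerp (Y : H →L[ℂ] H) (hY : IsSelfAdjoint Y) :
    (LinearMap.ker Y.toLinearMap)ᗮ →L[ℂ] (LinearMap.ker Y.toLinearMap)ᗮ :=
  (Y ∘L (LinearMap.ker Y.toLinearMap)ᗮ.subtypeL).codRestrict _ (by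
    intro x
    rw [Submodule.mem_orthogonal]
    intro u hu
    have hu' : Y u = 0 := hu
    have h := ContinuousLinearMap.adjoint_inner_left Y (x : H) u
    rw [ContinuousLinearMap.isSelfAdjoint_iff'.mp hY, hu', inner_zero_left] at h
    exact h.symm)

end HilbertSchmidt

/-! ### Pairs of projections -/

section Pairs

variable {H : Type*} [NormedAddCommGroup H] [InnerProductSpace ℂ H] [CompleteSpace H]

/-- The generic part of `(P, Q)`: the orthogonal complement of the sum of
`R(P) ∩ R(Q)`, `N(P) ∩ N(Q)`, `R(P) ∩ N(Q)` and `N(P) ∩ R(Q)`. -/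
def genericPart (P Q : H →L[ℂ] H) : Submodule ℂ H :=
  ((LinearMap.range P.toLinearMap ⊓ LinearMap.range Q.toLinearMap) ⊔
    (LinearMap.ker P.toLinearMap ⊓ LinearMap.ker Q.toLinearMap) ⊔
    (LinearMap.range P.toLinearMap ⊓ LinearMap.ker Q.toLinearMap) ⊔
    (LinearMap.ker P.toLinearMap ⊓ LinearMap.range Q.toLinearMap))ᗮ

/-- `(L, V, X)` is a Halmos decomposition of the generic part of the pair of projections `(P, Q)`:
`V` identifies the generic part with `L × L`, `X` is selfadjoint with `0 ≤ X ≤ π/2` and trivial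
nullspace, and on the generic part, with `C = cos X` and `S = sin X`,
`P = (1 0; 0 0)` and `Q = (C² CS; CS S²)`. -/
structure IsHalmosDecomposition (P Q : H →L[ℂ] H)
    {L : Type*} [NormedAddCommGroup L] [InnerProductSpace ℂ L] [CompleteSpace L]
    (V : genericPart P Q ≃ₗᵢ[ℂ] WithLp 2 (L × L)) (X : L →L[ℂ] L) : Prop where
  nonneg : 0 ≤ X
  le_pi_div_two : X ≤ (Real.pi / 2 : ℝ) • (1 : L →L[ℂ] L)
  ker_eq_bot : LinearMap.ker X.toLinearMap = ⊥
  apply_left : ∀ a b : L,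
    P (V.symm (WithLp.toLp 2 (a, b)) : H) = (V.symm (WithLp.toLp 2 (a, 0)) : H)
  apply_right : ∀ a b : L,
    Q (V.symm (WithLp.toLp 2 (a, b)) : H) = (V.symm (WithLp.toLp 2
      (opCos X (opCos X a) + opCos X (opSin X b),
        opCos X (opSin X a) + opSin X (opSin X b))) : H)

/-- The block operator `(0 -iX; iX 0)` on the Hilbert space `L × L`. -/
def codiagonalBlock {L : Type*} [NormedAddCommGroup L] [InnerProductSpace ℂ L]
    (X : L →L[ℂ] L) : WithLp 2 (L × L) →L[ℂ] WithLp 2 (L × L) :=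
  ((WithLp.prodContinuousLinearEquiv 2 ℂ L L).symm : L × L →L[ℂ] WithLp 2 (L × L)) ∘L
    (((-Complex.I) • X ∘L ContinuousLinearMap.snd ℂ L L).prod
      (Complex.I • X ∘L ContinuousLinearMap.fst ℂ L L)) ∘L
    (WithLp.prodContinuousLinearEquiv 2 ℂ L L : WithLp 2 (L × L) →L[ℂ] L × L)

/-- `Y` is co-diagonal with respect to the projection `P`: it maps `R(P)` into `N(P)` and
`N(P)` into `R(P)`. -/
def IsCodiagonal (P Y : H →L[ℂ] H) : Prop :=
  P * Y * P = 0 ∧ (1 - P) * Y * (1 - P) = 0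

/-- `Y` is an exponent of a geodesic `t ↦ e^{itY} P e^{-itY}` of length `π/2` from `P` to `Q`. -/
structure IsGeodesicExponent (P Q Y : H →L[ℂ] H) : Prop where
  isSelfAdjoint : IsSelfAdjoint Y
  norm_eq : ‖Y‖ = Real.pi / 2
  codiagonal_left : IsCodiagonal P Y
  codiagonal_right : IsCodiagonal Q Y
  conj_eq : NormedSpace.exp (Complex.I • Y) * P * NormedSpace.exp (-(Complex.I • Y)) = Q

end Pairs

/-! ### The projections `P_I` and `Q_J` -/

/-- `ℝⁿ` with its Euclidean structure. -/
abbrev Rn (n : ℕ) : Type := EuclideanSpace ℝ (Fin n)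

/-- The Hilbert space `L²(ℝⁿ, dx)` of complex-valued functions. -/
abbrev L2Rn (n : ℕ) : Type := Lp (α := Rn n) ℂ 2

theorem memLp_indicator_of_nullMeasurableSet {n : ℕ} {I : Set (Rn n)}
    (hI : NullMeasurableSet I volume) (f : L2Rn n) :
    MemLp (I.indicator (f : Rn n → ℂ)) 2 volume :=
  (Lp.memLp f).mono ((Lp.aestronglyMeasurable f).indicator₀ hI)
    (Filter.Eventually.of_forall fun x => norm_indicator_le_norm_self _ x)

/-- `P_I f = χ_I f` on `L²(ℝⁿ)`, for a Lebesgue measurable set `I`. -/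
def projP {n : ℕ} (I : Set (Rn n)) (hI : NullMeasurableSet I volume) : L2Rn n →L[ℂ] L2Rn n :=
  LinearMap.mkContinuous
    { toFun := fun f => (memLp_indicator_of_nullMeasurableSet hI f).toLp _
      map_add' := by
        intro f g
        rw [← MemLp.toLp_add, MemLp.toLp_eq_toLp_iff]
        filter_upwards [Lp.coeFn_add f g] with x hx
        by_cases h : x ∈ I
        · simpa [h] using hx
        · simp [h]
      map_smul' := by
        intro c f
        rw [RingHom.id_apply, ← MemLp.toLp_const_smul, MemLp.toLp_eq_toLp_iff]
        filter_upwards [Lp.coeFn_smul c f] with x hx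
        by_cases h : x ∈ I
        · simpa [h] using hx
        · simp [h] }
    1 (by
      intro f
      rw [one_mul]
      refine Lp.norm_le_norm_of_ae_le ?_
      filter_upwards [(memLp_indicator_of_nullMeasurableSet hI f).coeFn_toLp] with x hx
      simp only [LinearMap.coe_mk, AddHom.coe_mk]
      rw [hx]
      exact norm_indicator_le_norm_self _ x)

/-- The Fourier-Plancherel transformation of `L²(ℝⁿ)`, normalized by
`f̂(ξ) = ∫ f(x) exp(-2πi⟨x, ξ⟩) dx`. -/
def fourierU (n : ℕ) : L2Rn n ≃ₗᵢ[ℂ] L2Rn n := Lp.fourierTransformₗᵢ (Rn n) ℂ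

/-- `Q_J f = (χ_J f̂)ˇ` on `L²(ℝⁿ)`. -/
def projQ {n : ℕ} (J : Set (Rn n)) (hJ : NullMeasurableSet J volume) : L2Rn n →L[ℂ] L2Rn n :=
  ((fourierU n).symm.toContinuousLinearEquiv : L2Rn n →L[ℂ] L2Rn n) ∘L projP J hJ ∘L
    ((fourierU n).toContinuousLinearEquiv : L2Rn n →L[ℂ] L2Rn n)

end

/-! Everything is measured by the single operator `Q_J P_I`. Its squared Hilbert-Schmidt norm is
`|I||J|` (`hsNorm_projQ_mul_projP_sq`): at a frequency `ξ` the transforms of `P_I e`, with `e` in a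
Hilbert basis, are the coefficients of `χ_I` times a character, so their squares sum to `|I|`; then
integrate over `J`.

By `eq_zero_of_projP_eq_of_projQ_eq` the ranges of `P_I` and `Q_J` meet only in `0`, hence `QP`
vanishes off the generic part. In Halmos coordinates `‖QP(a, c)‖ = ‖cos X a‖`, so `cos X` has the
same Hilbert-Schmidt norm as `QP`; it is therefore compact and `X` is diagonalizable. A unit
eigenvector `(a, c)` of `X⁰` has `‖a‖² = 1/2`, which produces the factor `1/2`.

For a geodesic exponent `Y`, `cos Y` is diagonal and `sin Y` co-diagonal with respect to `P`, whence
`QP = e^{iY} cos Y P`. `P` halves the squared norm of eigenvectors with nonzero eigenvalue, and `QP`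
kills `N(Y)`. Diagonalizability follows from the compactness of `sin²Y cos²Y`.

Existence and uniqueness of `Y` rest on `e^{2iY} = (2Q - 1)(2P - 1)`. It determines `cos²Y` and `cos
Y sin Y`; `cos Y` is nonnegative, and injective when both mixed intersections vanish, so `sin Y` and
then `Y = arcsin(sin Y)` are determined. Conversely `-X⁰`, extended by `0`, satisfies this equation;
its norm reaches `π/2` because `R(P_I)` is infinite-dimensional while `∑ cos²γ` is finite. -/

set_option linter.unusedSectionVars false

noncomputable section

/-! ### Hilbert-Schmidt sums and compactness -/

section HilbertSchmidtLemmas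

variable {H : Type*} [NormedAddCommGroup H] [InnerProductSpace ℂ H] [CompleteSpace H]
variable {L : Type*} [NormedAddCommGroup L] [InnerProductSpace ℂ L] [CompleteSpace L]

theorem hsNorm_sq {ι : Type*} (b : HilbertBasis ι ℂ H) (T : H →L[ℂ] H) :
    hsNorm T ^ 2 = ∑' i, ‖T (b i)‖ₑ ^ 2 := by
  rw [hsNorm_eq b, ← ENNReal.rpow_natCast, ← ENNReal.rpow_mul]
  norm_num

theorem hsNorm_eq_rpow_of_sq_eq {T : H →L[ℂ] H} {s : ℝ≥0∞} (h : hsNorm T ^ 2 = s) :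
    hsNorm T = s ^ (1 / 2 : ℝ) := by
  rw [← h, ← ENNReal.rpow_natCast, ← ENNReal.rpow_mul]
  norm_num

theorem tsum_enorm_sq_comp_eq_adjoint {ι κ : Type*} (b : HilbertBasis ι ℂ L)
    (c : HilbertBasis κ ℂ H) (T : L →L[ℂ] H) :
    ∑' i, ‖T (b i)‖ₑ ^ 2 = ∑' j, ‖ContinuousLinearMap.adjoint T (c j)‖ₑ ^ 2 := by
  simp_rw [← fun i => c.tsum_enorm_inner_sq (T (b i)),
    ← fun j => b.tsum_enorm_inner_sq (ContinuousLinearMap.adjoint T (c j))]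
  rw [ENNReal.tsum_comm]
  refine tsum_congr fun j => tsum_congr fun i => ?_
  rw [ContinuousLinearMap.adjoint_inner_right, ← inner_conj_symm, RCLike.enorm_conj]

theorem LinearIsometry.adjoint_apply_self (U : L →ₗᵢ[ℂ] H) (a : L) :
    ContinuousLinearMap.adjoint U.toContinuousLinearMap (U a) = a := by
  refine ext_inner_left ℂ fun x => ?_
  rw [ContinuousLinearMap.adjoint_inner_right]
  exact U.inner_map_map x a

/-- The Hilbert-Schmidt sum along an orthonormal basis of a closed subspace outside of which the
operator vanishes. -/
theorem tsum_enorm_sq_comp_isometry {ι : Type*} (b : HilbertBasis ι ℂ L) (U : L →ₗᵢ[ℂ] H)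
    (T : H →L[ℂ] H) (hT : ∀ y, (∀ a, inner ℂ (U a) y = 0) → T y = 0) :
    ∑' i, ‖T (U (b i))‖ₑ ^ 2 = hsNorm T ^ 2 := by
  obtain ⟨w, c, -⟩ := exists_hilbertBasis ℂ H
  rw [hsNorm_sq c, tsum_enorm_sq_adjoint c c]
  have h := tsum_enorm_sq_comp_eq_adjoint b c (T ∘L U.toContinuousLinearMap)
  simp only [ContinuousLinearMap.comp_apply, LinearIsometry.coe_toContinuousLinearMap] at h
  rw [h]
  refine tsum_congr fun j => ?_
  rw [ContinuousLinearMap.adjoint_comp, ContinuousLinearMap.comp_apply]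
  set z := ContinuousLinearMap.adjoint T (c j) with hz
  set p := ContinuousLinearMap.adjoint U.toContinuousLinearMap z with hp
  -- `T` kills the orthogonal complement of the range of `U`, so `z`, being in the range of `T*`,
  -- lies in the range of `U`, and `U*` preserves its norm.
  have h1 : ∀ a, inner ℂ (U a) (z - U p) = 0 := by
    intro a
    rw [inner_sub_right, U.inner_map_map, hp,
      ContinuousLinearMap.adjoint_inner_right U.toContinuousLinearMap]
    exact sub_self _
  have h2 : z - U p = 0 := by
    rw [← inner_self_eq_zero (𝕜 := ℂ), inner_sub_right, ← inner_conj_symm _ (U p), h1 p, hz,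
      ContinuousLinearMap.adjoint_inner_right, hT _ h1]
    simp
  have h3 : ‖p‖ₑ = ‖z‖ₑ := by
    rw [sub_eq_zero.mp h2, enorm_eq_iff_norm_eq, U.norm_map]
  rw [h3]

/-- On the adjoint side `U*` is a contraction. This version, with no vanishing condition on `T`,
serves to bound the dimension of spaces of fixed vectors. -/
theorem tsum_enorm_sq_comp_isometry_le {ι : Type*} (b : HilbertBasis ι ℂ L) (U : L →ₗᵢ[ℂ] H)
    (T : H →L[ℂ] H) : ∑' i, ‖T (U (b i))‖ₑ ^ 2 ≤ hsNorm T ^ 2 := by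
  obtain ⟨w, c, -⟩ := exists_hilbertBasis ℂ H
  rw [hsNorm_sq c, tsum_enorm_sq_adjoint c c]
  have h := tsum_enorm_sq_comp_eq_adjoint b c (T ∘L U.toContinuousLinearMap)
  simp only [ContinuousLinearMap.comp_apply, LinearIsometry.coe_toContinuousLinearMap] at h
  rw [h]
  refine ENNReal.tsum_le_tsum fun j => ?_
  rw [ContinuousLinearMap.adjoint_comp, ContinuousLinearMap.comp_apply]
  gcongr
  rw [enorm_le_iff_norm_le]
  refine (ContinuousLinearMap.le_opNorm _ _).trans ?_
  rw [LinearIsometryEquiv.norm_map]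
  have := U.norm_toContinuousLinearMap_le
  nlinarith [norm_nonneg (ContinuousLinearMap.adjoint T (c j))]

/-- Parseval for `T x`, then Cauchy-Schwarz on each coefficient `⟨T* c_j, x⟩`. -/
theorem enorm_apply_sq_le_hsNorm (T : H →L[ℂ] H) {x : H} :
    ‖T x‖ₑ ^ 2 ≤ hsNorm T ^ 2 * ‖x‖ₑ ^ 2 := by
  obtain ⟨w, c, -⟩ := exists_hilbertBasis ℂ H
  rw [hsNorm_sq c, tsum_enorm_sq_adjoint c c, ← c.tsum_enorm_inner_sq (T x),
    ← ENNReal.tsum_mul_right]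
  refine ENNReal.tsum_le_tsum fun j => ?_
  rw [← ContinuousLinearMap.adjoint_inner_left, ← mul_pow]
  gcongr
  have := norm_inner_le_norm (𝕜 := ℂ) (ContinuousLinearMap.adjoint T (c j)) x
  rw [← ofReal_norm, ← ofReal_norm, ← ofReal_norm, ← ENNReal.ofReal_mul (norm_nonneg _)]
  exact ENNReal.ofReal_le_ofReal this

theorem isCompactOperator_of_hsNorm_ne_top (T : H →L[ℂ] H) (hT : hsNorm T ≠ ∞) :
    IsCompactOperator T := by
  classical
  obtain ⟨w, c, -⟩ := exists_hilbertBasis ℂ H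
  have hsum : ∑' i, ‖T (c i)‖ₑ ^ 2 ≠ ∞ := by
    rw [← hsNorm_sq c]; exact ENNReal.pow_ne_top hT
  -- Finite-rank truncations: the squared Hilbert-Schmidt norm of `T - F s` is the tail of a
  -- convergent sum, and it dominates the squared operator norm.
  let F : Finset w → H →L[ℂ] H := fun s => ∑ i ∈ s, (innerSL ℂ (c i)).smulRight (T (c i))
  have hFc : ∀ s j, F s (c j) = if j ∈ s then T (c j) else 0 := by
    intro s j
    simp only [F, sum_apply, ContinuousLinearMap.smulRight_apply,
      innerSL_apply_apply, orthonormal_iff_ite.mp c.orthonormal, ite_smul, one_smul, zero_smul]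
    simp
  have hn : ∀ s, ENNReal.ofReal (‖T - F s‖ ^ 2) ≤ ∑' i : {i // i ∉ s}, ‖T (c i)‖ₑ ^ 2 := by
    intro s
    have h0 : hsNorm (T - F s) ^ 2 = ∑' i : {i // i ∉ s}, ‖T (c i)‖ₑ ^ 2 := by
      rw [hsNorm_sq c, show (∑' i : {i // i ∉ s}, ‖T (c i)‖ₑ ^ 2) =
        ∑' i : ((s : Set w)ᶜ : Set w), ‖T (c i)‖ₑ ^ 2 from rfl, tsum_subtype (f := fun i => ‖T (c i)‖ₑ ^ 2)]
      refine tsum_congr fun j => ?_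
      rw [sub_apply, hFc]
      by_cases hj : j ∈ s <;> simp [hj]
    rw [← h0]
    have hfin : hsNorm (T - F s) ^ 2 ≠ ∞ := by
      rw [h0]
      exact ne_top_of_le_ne_top hsum (ENNReal.tsum_comp_le_tsum_of_injective
        Subtype.val_injective _)
    have hb : ‖T - F s‖ ≤ (hsNorm (T - F s)).toReal := by
      refine ContinuousLinearMap.opNorm_le_bound _ ENNReal.toReal_nonneg fun x => ?_
      have h1 := enorm_apply_sq_le_hsNorm (T - F s) (x := x)
      rw [← mul_pow] at h1
      have h2 := (ENNReal.pow_le_pow_left_iff two_ne_zero).mp h1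
      have h3 := ENNReal.toReal_mono (ENNReal.mul_ne_top
        (fun h => hfin (by rw [h]; simp)) enorm_ne_top) h2
      simpa using h3
    have hfin' : hsNorm (T - F s) ≠ ∞ := fun h => hfin (by rw [h]; simp)
    rw [ENNReal.ofReal_pow (norm_nonneg _)]
    gcongr
    exact ENNReal.ofReal_le_of_le_toReal hb
  have ht := ENNReal.tendsto_tsum_compl_atTop_zero hsum
  have htend : Filter.Tendsto F Filter.atTop (nhds T) := by
    have h1 : Filter.Tendsto (fun s => ENNReal.ofReal (‖T - F s‖ ^ 2)) Filter.atTop (nhds 0) :=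
      tendsto_of_tendsto_of_tendsto_of_le_of_le tendsto_const_nhds ht (fun _ => zero_le) hn
    have h2 : Filter.Tendsto (fun s => ‖T - F s‖ ^ 2) Filter.atTop (nhds 0) := by
      have h3 := (ENNReal.tendsto_toReal ENNReal.zero_ne_top).comp h1
      refine h3.congr fun s => ?_
      simp
    have h4 : Filter.Tendsto (fun s => ‖F s - T‖) Filter.atTop (nhds 0) := by
      have h5 := h2.sqrt
      simp only [Real.sqrt_zero] at h5
      refine h5.congr fun s => ?_
      rw [Real.sqrt_sq (norm_nonneg _), norm_sub_rev]
    exact tendsto_iff_norm_sub_tendsto_zero.mpr h4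
  refine isCompactOperator_of_tendsto htend (Filter.Eventually.of_forall fun s => ?_)
  refine Finset.sum_induction (fun i => (innerSL ℂ (c i)).smulRight (T (c i)))
    (fun G : H →L[ℂ] H => IsCompactOperator G) (fun a b ha hb => ha.add hb)
    isCompactOperator_zero fun i _ => ?_
  have hK := isCompactOperator_of_locallyCompactSpace_rng
    (ContinuousLinearMap.toSpanSingleton ℂ (T (c i)))
  exact hK.comp_clm (innerSL ℂ (c i))

end HilbertSchmidtLemmas

/-! ### Hilbert bases of eigenvectors and functional calculus on eigenvectors -/

section Eigenbases

variable {H : Type*} [NormedAddCommGroup H] [InnerProductSpace ℂ H] [CompleteSpace H]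

open Module.End in
-- Hilbert bases of the mutually orthogonal real eigenspaces are put together; `hd` says that the
-- eigenvectors are total. In this form diagonalizability passes from `f(T)` to `T` whenever `T =
-- g(f(T))`. `H : Type` keeps the index in `Type`, as `EigenvalueSumEq` asks.
theorem exists_isEigenbasis {H : Type} [NormedAddCommGroup H] [InnerProductSpace ℂ H]
    [CompleteSpace H] {T : H →L[ℂ] H} (hT : IsSelfAdjoint T)
    (hd : ∀ x, (∀ (μ : ℝ) (v : H), T v = (μ : ℂ) • v → inner ℂ v x = 0) → x = 0) :
    ∃ (ι : Type) (b : HilbertBasis ι ℂ H) (γ : ι → ℝ), IsEigenbasis T b γ := by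
  have hsym : (T : H →ₗ[ℂ] H).IsSymmetric := hT.isSymmetric
  have hcl : ∀ μ : ℂ, IsClosed (eigenspace (T : H →ₗ[ℂ] H) μ : Set H) := by
    intro μ
    have : (eigenspace (T : H →ₗ[ℂ] H) μ : Set H) = {x | T x = μ • x} := by
      ext x; simp
    rw [this]
    exact isClosed_eq T.continuous (continuous_const_smul μ)
  have : ∀ μ : ℂ, CompleteSpace (eigenspace (T : H →ₗ[ℂ] H) μ) :=
    fun μ => (hcl μ).completeSpace_coe
  choose w c hc using fun μ : ℝ => exists_hilbertBasis ℂ (eigenspace (T : H →ₗ[ℂ] H) (μ : ℂ))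
  let v : (Σ μ : ℝ, w μ) → H := fun a => (c a.1 a.2 : H)
  have hfam : OrthogonalFamily ℂ (fun μ : ℝ => eigenspace (T : H →ₗ[ℂ] H) (μ : ℂ))
      fun μ => (eigenspace (T : H →ₗ[ℂ] H) (μ : ℂ)).subtypeₗᵢ :=
    hsym.orthogonalFamily_eigenspaces.comp Complex.ofReal_injective
  have hv : Orthonormal ℂ v := hfam.orthonormal_sigma_orthonormal fun μ => (c μ).orthonormal
  have hev : ∀ a, T (v a) = (a.1 : ℂ) • v a := fun a => mem_eigenspace_iff.mp (c a.1 a.2).2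
  have hbot : (Submodule.span ℂ (Set.range v))ᗮ = ⊥ := by
    rw [Submodule.eq_bot_iff]
    intro x hx
    refine hd x fun μ y hy => ?_
    let y' : eigenspace (T : H →ₗ[ℂ] H) (μ : ℂ) := ⟨y, mem_eigenspace_iff.mpr hy⟩
    have h1 := ((c μ).hasSum_repr y').mapL
      ((eigenspace (T : H →ₗ[ℂ] H) (μ : ℂ)).subtypeL)
    have h2 := h1.mapL (innerSL ℂ x)
    have h3 : ∀ i, (innerSL ℂ x) ((eigenspace (T : H →ₗ[ℂ] H) (μ : ℂ)).subtypeL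
        ((c μ).repr y' i • (c μ) i)) = 0 := by
      intro i
      rw [map_smul, map_smul, innerSL_apply_apply]
      have : inner ℂ x (v ⟨μ, i⟩) = 0 :=
        Submodule.inner_left_of_mem_orthogonal (Submodule.subset_span (Set.mem_range_self _)) hx
      erw [this, smul_zero]
    simp only [h3] at h2
    have h4 : inner ℂ x y = 0 := h2.unique hasSum_zero
    rw [← inner_conj_symm, h4, map_zero]
  exact ⟨_, HilbertBasis.mkOfOrthogonalEqBot hv hbot, fun a => a.1, fun i => by simp [hev]⟩

theorem HilbertBasis.eq_zero_of_inner {ι : Type*} {b : HilbertBasis ι ℂ H} {x : H}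
    (h : ∀ i, inner ℂ (b i) x = 0) : x = 0 := by
  have h1 := b.hasSum_repr x
  simp only [b.repr_apply_apply, h, zero_smul] at h1
  exact h1.unique hasSum_zero

theorem ext_hilbertBasis {F : Type*} [NormedAddCommGroup F] [NormedSpace ℂ F]
    {ι : Type*} (b : HilbertBasis ι ℂ H) {S T : H →L[ℂ] F} (h : ∀ i, S (b i) = T (b i)) :
    S = T := by
  ext x
  have h1 := (b.hasSum_repr x).mapL S
  have h2 := (b.hasSum_repr x).mapL T
  simp only [map_smul, h] at h1 h2
  exact h1.unique h2

/-- The functions for which the formula holds contain the constants and the identity, are stable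
under sums and products, and form a closed set: Stone-Weierstrass on the spectrum. -/
theorem cfc_apply_eigenvector {T : H →L[ℂ] H} (hT : IsSelfAdjoint T) {γ : ℝ} {v : H}
    (hv : T v = (γ : ℂ) • v) {f : ℝ → ℝ} (hf : Continuous f) :
    cfc f T v = (f γ : ℂ) • v := by
  by_cases hv0 : v = 0
  · simp [hv0]
  have hmem : γ ∈ spectrum ℝ T := by
    rw [spectrum.mem_iff]
    intro hu
    obtain ⟨u, hu⟩ := hu
    have h1 : (u : H →L[ℂ] H) v = 0 := by
      rw [hu, sub_apply, hv, ContinuousLinearMap.algebraMap_apply]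
      simp
    have h2 : (↑u⁻¹ * ↑u : H →L[ℂ] H) v = 0 := by
      change (↑u⁻¹ : H →L[ℂ] H) ((u : H →L[ℂ] H) v) = 0
      rw [h1, map_zero]
    rw [Units.inv_mul] at h2
    exact hv0 h2
  rw [cfc_apply f T hT hf.continuousOn]
  have key : ∀ g : C(spectrum ℝ T, ℝ), cfcHom hT g v = (g ⟨γ, hmem⟩ : ℂ) • v := by
    intro g
    induction g using ContinuousMap.induction_on_of_compact with
    | const r =>
      rw [show ContinuousMap.const (spectrum ℝ T) r = algebraMap ℝ C(spectrum ℝ T, ℝ) r from rfl,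
        AlgHomClass.commutes]
      simp [ContinuousLinearMap.algebraMap_apply]
    | id => rw [cfcHom_id]; simpa using hv
    | star_id =>
      rw [map_star, cfcHom_id, hT.star_eq]; simpa using hv
    | add f g hf hg => simp [map_add, hf, hg, add_smul]
    | mul f g hf hg =>
      rw [map_mul]
      change cfcHom hT f (cfcHom hT g v) = _
      rw [hg, map_smul, hf, smul_smul]
      simp [mul_comm]
    | frequently f hf =>
      refine hf.mem_of_closed (isClosed_eq ?_ ?_)
      · exact ((ContinuousLinearMap.apply ℂ H v).continuous).comp (cfcHom_continuous hT)
      · exact (Complex.continuous_ofReal.comp (continuous_eval_const _)).smul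
          continuous_const
  exact key _

end Eigenbases

/-! ### Spectral theorem for compact operators and a variant -/

section Diagonalization

variable {H : Type*} [NormedAddCommGroup H] [InnerProductSpace ℂ H] [CompleteSpace H]

open Module.End in
theorem LinearMap.IsSymmetric.eq_zero_of_inner_eigenvector {K : Type*} [NormedAddCommGroup K]
    [InnerProductSpace ℂ K] {T : K →ₗ[ℂ] K} (hT : T.IsSymmetric)
    (hbot : (⨆ μ, eigenspace T μ)ᗮ = ⊥) {x : K}
    (hx : ∀ (μ : ℝ) (v : K), T v = (μ : ℂ) • v → inner ℂ v x = 0) : x = 0 := by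
  rw [← Submodule.mem_bot ℂ, ← hbot, ← Submodule.iInf_orthogonal, Submodule.mem_iInf]
  intro μ
  rw [Submodule.mem_orthogonal]
  intro v hv
  by_cases hv0 : v = 0
  · simp [hv0]
  have hev : HasEigenvalue T μ := hasEigenvalue_of_hasEigenvector ⟨hv, hv0⟩
  have h1 := hT.conj_eigenvalue_eq_self hev
  rw [Complex.conj_eq_iff_re] at h1
  exact hx μ.re v (by rw [h1]; exact mem_eigenspace_iff.mp hv)

theorem IsCompactOperator.eq_zero_of_inner_eigenvector {T : H →L[ℂ] H}
    (hc : IsCompactOperator T) (hT : IsSelfAdjoint T) {x : H}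
    (hx : ∀ (μ : ℝ) (v : H), T v = (μ : ℂ) • v → inner ℂ v x = 0) : x = 0 :=
  LinearMap.IsSymmetric.eq_zero_of_inner_eigenvector (T := (T : H →ₗ[ℂ] H)) hT.isSymmetric
    (ContinuousLinearMap.orthogonalComplement_iSup_eigenspaces_eq_bot hc hT.isSymmetric) hx

/-- Made for `S = sin Y`, where `S² - S⁴ = sin²Y cos²Y` is compact although `S` need not be. `S`
preserves each eigenspace of `S² - S⁴`: the nonzero ones are finite-dimensional, and on the kernel
`S² = S⁴` leaves only the eigenvalues `0`, `1`, `-1`. -/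
theorem eq_zero_of_inner_eigenvector_of_sq_sub_pow_four {S : H →L[ℂ] H} (hS : IsSelfAdjoint S)
    (hc : IsCompactOperator (S ^ 2 - S ^ 4 : H →L[ℂ] H)) {x : H}
    (hx : ∀ (μ : ℝ) (v : H), S v = (μ : ℂ) • v → inner ℂ v x = 0) : x = 0 := by
  have hG : IsSelfAdjoint (S ^ 2 - S ^ 4) := (hS.pow 2).sub (hS.pow 4)
  refine hc.eq_zero_of_inner_eigenvector hG fun l y hy => ?_
  have hGa : ∀ z, (S ^ 2 - S ^ 4 : H →L[ℂ] H) z = S (S z) - S (S (S (S z))) := fun z => rfl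
  rw [hGa] at hy
  by_cases hl : l = 0
  · rw [hl, Complex.ofReal_zero, zero_smul] at hy
    have hsym : ∀ a b, inner ℂ (S a) b = inner ℂ a (S b) := hS.isSymmetric
    -- With `d = y - S²y`: `‖S d‖² = ⟨d, S²y - S⁴y⟩ = 0`.
    have h0 : S (y - S (S y)) = 0 := by
      rw [← inner_self_eq_zero (𝕜 := ℂ), hsym, map_sub, map_sub, hy, inner_zero_right]
    have e0 := hx 0 (y - S (S y)) (by simp [h0])
    have h3 : S (S (S y)) = S y := by
      rw [map_sub, sub_eq_zero] at h0; exact h0.symm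
    have e1 := hx 1 (S (S y) + S y) (by simp [map_add, h3, add_comm])
    have e2 := hx (-1) (S (S y) - S y) (by simp [map_sub, h3])
    -- The three vectors are eigenvectors of `S` for `0`, `1` and `-1`.
    have hdec : y = (y - S (S y)) + (2⁻¹ : ℂ) • ((S (S y) + S y) + (S (S y) - S y)) := by
      module
    rw [hdec, inner_add_left, e0, inner_smul_left, inner_add_left, e1, e2]
    simp
  · have hl' : (l : ℂ) ≠ 0 := by exact_mod_cast hl
    let E := Module.End.eigenspace ((S ^ 2 - S ^ 4 : H →L[ℂ] H) : H →ₗ[ℂ] H) (l : ℂ)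
    have : FiniteDimensional ℂ E := ContinuousLinearMap.finite_dimensional_eigenspace hc _ hl'
    have hmem : ∀ z, z ∈ E ↔ S (S z) - S (S (S (S z))) = (l : ℂ) • z := fun z =>
      Module.End.mem_eigenspace_iff
    have hinv : ∀ z ∈ E, (S : H →ₗ[ℂ] H) z ∈ E := by
      intro z hz
      rw [hmem] at hz ⊢
      have := congrArg S hz
      simpa using this
    have hsym : ((S : H →ₗ[ℂ] H).restrict hinv).IsSymmetric :=
      LinearMap.IsSymmetric.restrict_invariant hS.isSymmetric hinv
    -- An eigenvector of the restriction of `S` to `E` is one of `S`, and pairs with the projection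
    -- of `x` as it does with `x`.
    have hp : E.orthogonalProjectionOnto x = 0 := by
      refine hsym.eq_zero_of_inner_eigenvector hsym.orthogonalComplement_iSup_eigenspaces_eq_bot
        fun μ v hv => ?_
      rw [Submodule.inner_orthogonalProjectionOnto_eq_of_mem_left]
      refine hx μ v ?_
      exact congrArg Subtype.val hv
    have h := Submodule.inner_orthogonalProjectionOnto_eq_of_mem_left
      (⟨y, (hmem y).mpr hy⟩ : E) x
    rw [hp, inner_zero_right] at h
    exact h.symm

end Diagonalization

/-! ### The unitary `e^{iY}` as `cos Y + i sin Y` -/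

section Exponential

variable {H : Type*} [NormedAddCommGroup H] [InnerProductSpace ℂ H] [CompleteSpace H]

theorem exp_I_smul_eq_cos_add_sin {Y : H →L[ℂ] H} (hY : IsSelfAdjoint Y) :
    NormedSpace.exp (Complex.I • Y) = cfc Real.cos Y + Complex.I • cfc Real.sin Y := by
  have hn : IsStarNormal Y := hY.isStarNormal
  have hn2 : IsStarNormal (Complex.I • Y) := by
    constructor
    rw [star_smul, hY.star_eq]
    exact (Commute.refl Y).smul_left _ |>.smul_right _
  rw [← CFC.complex_exp_eq_normedSpace_exp hn2,
    ← cfc_comp_const_mul Complex.I Complex.exp Y (by fun_prop) hn,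
    cfc_real_eq_complex Real.cos hY, cfc_real_eq_complex Real.sin hY,
    ← cfc_const_mul Complex.I _ Y (by fun_prop), ← cfc_add (a := Y) _ _ (by fun_prop) (by fun_prop)]
  refine cfc_congr fun z hz => ?_
  have hre : z = (z.re : ℂ) := hY.mem_spectrum_eq_re hz
  rw [hre]
  simp only [Complex.ofReal_re]
  rw [mul_comm, Complex.exp_mul_I, Complex.ofReal_cos, Complex.ofReal_sin, mul_comm Complex.I]

theorem exp_neg_I_smul_eq_cos_sub_sin {Y : H →L[ℂ] H} (hY : IsSelfAdjoint Y) :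
    NormedSpace.exp (-(Complex.I • Y)) = cfc Real.cos Y - Complex.I • cfc Real.sin Y := by
  have h := exp_I_smul_eq_cos_add_sin hY.neg
  rw [smul_neg] at h
  rw [h, ← cfc_comp_neg Real.cos Y, ← cfc_comp_neg Real.sin Y]
  simp only [Real.cos_neg, Real.sin_neg]
  rw [cfc_neg, smul_neg, sub_eq_add_neg]

theorem exp_I_smul_apply_eigenvector {Y : H →L[ℂ] H} (hY : IsSelfAdjoint Y) {μ : ℝ} {v : H}
    (hv : Y v = (μ : ℂ) • v) :
    NormedSpace.exp (Complex.I • Y) v = Complex.exp (μ * Complex.I) • v := by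
  rw [exp_I_smul_eq_cos_add_sin hY, add_apply, smul_apply,
    cfc_apply_eigenvector hY hv Real.continuous_cos,
    cfc_apply_eigenvector hY hv Real.continuous_sin, Complex.exp_mul_I, Complex.ofReal_cos,
    Complex.ofReal_sin]
  module

end Exponential

/-! ### Geodesic exponents: algebra, uniqueness, diagonalizability -/

section Geodesic

variable {H : Type*} [NormedAddCommGroup H] [InnerProductSpace ℂ H] [CompleteSpace H]
variable {P Q Y : H →L[ℂ] H}

theorem exp_I_smul_mul_exp_neg (Y : H →L[ℂ] H) :
    NormedSpace.exp (Complex.I • Y) * NormedSpace.exp (-(Complex.I • Y)) = 1 := by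
  let : NormedAlgebra ℚ (H →L[ℂ] H) := NormedAlgebra.restrictScalars ℚ ℂ _
  rw [← NormedSpace.exp_add_of_commute (Commute.neg_right (Commute.refl _)), add_neg_cancel,
    NormedSpace.exp_zero]

theorem exp_neg_mul_exp_I_smul (Y : H →L[ℂ] H) :
    NormedSpace.exp (-(Complex.I • Y)) * NormedSpace.exp (Complex.I • Y) = 1 := by
  let : NormedAlgebra ℚ (H →L[ℂ] H) := NormedAlgebra.restrictScalars ℚ ℂ _
  rw [← NormedSpace.exp_add_of_commute (Commute.neg_left (Commute.refl _)), neg_add_cancel,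
    NormedSpace.exp_zero]

theorem star_exp_I_smul (hY : IsSelfAdjoint Y) :
    star (NormedSpace.exp (Complex.I • Y)) = NormedSpace.exp (-(Complex.I • Y)) := by
  rw [exp_I_smul_eq_cos_add_sin hY, exp_neg_I_smul_eq_cos_sub_sin hY, star_add, star_smul,
    (cfc_predicate Real.cos Y : IsSelfAdjoint _).star_eq,
    (cfc_predicate Real.sin Y : IsSelfAdjoint _).star_eq]
  simp [sub_eq_add_neg]

theorem norm_exp_I_smul_apply (hY : IsSelfAdjoint Y) (x : H) :
    ‖NormedSpace.exp (Complex.I • Y) x‖ = ‖x‖ := by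
  have h : (inner ℂ (NormedSpace.exp (Complex.I • Y) x) (NormedSpace.exp (Complex.I • Y) x) : ℂ)
      = inner ℂ x x := by
    rw [← ContinuousLinearMap.adjoint_inner_right, ← ContinuousLinearMap.star_eq_adjoint,
      star_exp_I_smul hY]
    change inner ℂ x ((NormedSpace.exp (-(Complex.I • Y)) * NormedSpace.exp (Complex.I • Y)) x) = _
    rw [exp_neg_mul_exp_I_smul]
    rfl
  rw [inner_self_eq_norm_sq_to_K, inner_self_eq_norm_sq_to_K] at h
  have h2 : ‖NormedSpace.exp (Complex.I • Y) x‖ ^ 2 = ‖x‖ ^ 2 := by exact_mod_cast h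
  exact (sq_eq_sq₀ (norm_nonneg _) (norm_nonneg _)).mp h2

/-- The linear form of co-diagonality; for an idempotent `P` the converse also holds, and the later
computations use this form. -/
theorem IsCodiagonal.add_eq (h : IsCodiagonal P Y) : P * Y + Y * P = Y := by
  have h2 : (1 - P) * Y * (1 - P) = Y - (P * Y + Y * P) + P * Y * P := by noncomm_ring
  rw [h.2, h.1, add_zero] at h2
  exact (sub_eq_zero.mp h2.symm).symm

theorem isCodiagonal_of_add_eq (hP : P * P = P) (h : P * Y + Y * P = Y) : IsCodiagonal P Y := by
  have h1 : P * Y * P = 0 := by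
    have h2 := congrArg (P * ·) h
    simp only [mul_add, ← mul_assoc, hP] at h2
    simpa using h2
  refine ⟨h1, ?_⟩
  have h2 : (1 - P) * Y * (1 - P) = Y - (P * Y + Y * P) + P * Y * P := by noncomm_ring
  rw [h2, h1, h, sub_self, add_zero]

/-- The symmetry `2P - 1` of a projection conjugates a co-diagonal operator to its negative. -/
theorem symmetry_mul_exp (hP : P * P = P) (h : IsCodiagonal P Y) :
    (2 * P - 1) * NormedSpace.exp (Complex.I • Y) =
      NormedSpace.exp (-(Complex.I • Y)) * (2 * P - 1) := by
  let : NormedAlgebra ℚ (H →L[ℂ] H) := NormedAlgebra.restrictScalars ℚ ℂ _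
  have h1 : (2 * P - 1) * (2 * P - 1) = 1 := by
    have : (2 * P - 1) * (2 * P - 1) = 4 * (P * P) - 4 * P + 1 := by noncomm_ring
    rw [this, hP]; simp
  let u : (H →L[ℂ] H)ˣ := ⟨2 * P - 1, 2 * P - 1, h1, h1⟩
  have h2 : (2 * P - 1) * Y = -Y * (2 * P - 1) := by
    have : (2 * P - 1) * Y + Y * (2 * P - 1) = 2 * (P * Y + Y * P) - 2 * Y := by noncomm_ring
    rw [h.add_eq, sub_self] at this
    rw [neg_mul]
    exact eq_neg_of_add_eq_zero_left this
  have h3 : (u : H →L[ℂ] H) * (Complex.I • Y) * (↑u⁻¹ : H →L[ℂ] H) = -(Complex.I • Y) := by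
    change (2 * P - 1) * (Complex.I • Y) * (2 * P - 1) = _
    rw [mul_smul_comm, h2, smul_mul_assoc, mul_assoc, h1, mul_one, smul_neg]
  have h4 := NormedSpace.exp_units_conj u (Complex.I • Y)
  rw [h3] at h4
  rw [h4]
  change _ = (2 * P - 1) * NormedSpace.exp (Complex.I • Y) * (2 * P - 1) * (2 * P - 1)
  rw [mul_assoc _ (2 * P - 1) (2 * P - 1), h1, mul_one]

theorem two_smul_cos_eq (hY : IsSelfAdjoint Y) : (2 : ℂ) • cfc Real.cos Y =
    NormedSpace.exp (Complex.I • Y) + NormedSpace.exp (-(Complex.I • Y)) := by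
  rw [exp_I_smul_eq_cos_add_sin hY, exp_neg_I_smul_eq_cos_sub_sin hY]
  module

theorem two_I_smul_sin_eq (hY : IsSelfAdjoint Y) : (2 * Complex.I) • cfc Real.sin Y =
    NormedSpace.exp (Complex.I • Y) - NormedSpace.exp (-(Complex.I • Y)) := by
  rw [exp_I_smul_eq_cos_add_sin hY, exp_neg_I_smul_eq_cos_sub_sin hY]
  module

theorem symmetry_mul_exp_neg (hP : P * P = P) (h : IsCodiagonal P Y) :
    (2 * P - 1) * NormedSpace.exp (-(Complex.I • Y)) =
      NormedSpace.exp (Complex.I • Y) * (2 * P - 1) := by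
  have h2 := symmetry_mul_exp hP h
  calc (2 * P - 1) * NormedSpace.exp (-(Complex.I • Y))
      = NormedSpace.exp (Complex.I • Y) * (NormedSpace.exp (-(Complex.I • Y)) * (2 * P - 1))
          * NormedSpace.exp (-(Complex.I • Y)) := by
        rw [← mul_assoc, exp_I_smul_mul_exp_neg, one_mul]
    _ = NormedSpace.exp (Complex.I • Y) * (2 * P - 1) := by
        rw [← h2, mul_assoc, mul_assoc, exp_I_smul_mul_exp_neg, mul_one]

/-- Conjugation by `2P - 1` exchanges `e^{iY}` and `e^{-iY}`; it therefore fixes their half-sum `cos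
Y` and, in the next lemma, changes the sign of `sin Y`. -/
theorem symmetry_mul_cos (hP : P * P = P) (hY : IsSelfAdjoint Y) (h : IsCodiagonal P Y) :
    (2 * P - 1) * cfc Real.cos Y = cfc Real.cos Y * (2 * P - 1) := by
  refine smul_right_injective _ (two_ne_zero (α := ℂ)) ?_
  simp only
  rw [← mul_smul_comm, ← smul_mul_assoc, two_smul_cos_eq hY, mul_add, add_mul,
    symmetry_mul_exp hP h, symmetry_mul_exp_neg hP h, add_comm]

theorem symmetry_mul_sin (hP : P * P = P) (hY : IsSelfAdjoint Y) (h : IsCodiagonal P Y) :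
    (2 * P - 1) * cfc Real.sin Y = -(cfc Real.sin Y * (2 * P - 1)) := by
  refine smul_right_injective _ (mul_ne_zero (two_ne_zero (α := ℂ)) Complex.I_ne_zero) ?_
  simp only
  rw [← mul_smul_comm, smul_neg, ← smul_mul_assoc, two_I_smul_sin_eq hY, mul_sub (2 * P - 1),
    sub_mul _ _ (2 * P - 1), symmetry_mul_exp hP h, symmetry_mul_exp_neg hP h, neg_sub]

theorem proj_mul_cos (hP : P * P = P) (hY : IsSelfAdjoint Y) (h : IsCodiagonal P Y) :
    P * cfc Real.cos Y = cfc Real.cos Y * P := by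
  have h1 := symmetry_mul_cos hP hY h
  have h2 : 2 * (P * cfc Real.cos Y) = 2 * (cfc Real.cos Y * P) := by
    rw [sub_mul, mul_sub, one_mul, mul_one, sub_left_inj] at h1
    rw [← mul_assoc, h1, ← mul_assoc, ← mul_assoc]
    noncomm_ring
  refine smul_right_injective _ (two_ne_zero (α := ℂ)) ?_
  simpa only [two_smul, two_mul] using h2

theorem sin_mul_proj (hP : P * P = P) (hY : IsSelfAdjoint Y) (h : IsCodiagonal P Y) :
    cfc Real.sin Y * P = (1 - P) * cfc Real.sin Y := by
  have h1 := symmetry_mul_sin hP hY h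
  set S := cfc Real.sin Y
  have h2 : 2 * (S * P) = 2 * ((1 - P) * S) := by
    have e1 : 2 * (S * P) = S * (2 * P - 1) + S := by noncomm_ring
    have e2 : 2 * ((1 - P) * S) = -((2 * P - 1) * S) + S := by noncomm_ring
    rw [e1, e2, h1, neg_neg]
  refine smul_right_injective _ (two_ne_zero (α := ℂ)) ?_
  simpa only [two_smul, two_mul] using h2

namespace IsGeodesicExponent

/-- `P sin Y P = 0` since the sine is co-diagonal, so `P e^{-iY} P = cos Y P`. This gives access to
`QP` through the eigenvalues of `Y`. -/
theorem mul_eq (hP : P * P = P) (h : IsGeodesicExponent P Q Y) :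
    Q * P = NormedSpace.exp (Complex.I • Y) * (cfc Real.cos Y * P) := by
  have hs := sin_mul_proj hP h.isSelfAdjoint h.codiagonal_left
  have hc := proj_mul_cos hP h.isSelfAdjoint h.codiagonal_left
  have h1 : P * cfc Real.sin Y * P = 0 := by
    rw [mul_assoc, hs, ← mul_assoc, mul_sub, mul_one, hP, sub_self, zero_mul]
  rw [← h.conj_eq, exp_neg_I_smul_eq_cos_sub_sin h.isSelfAdjoint, mul_assoc, mul_assoc, sub_mul,
    mul_sub, smul_mul_assoc, mul_smul_comm, ← mul_assoc P (cfc Real.sin Y), h1, smul_zero, sub_zero,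
    ← mul_assoc P, hc, mul_assoc, hP]

/-- In `e^{iY}(2P - 1)e^{-iY}` the symmetry turns the right factor into `e^{iY}` as it passes to its
left. -/
theorem symmetry_eq (hP : P * P = P) (h : IsGeodesicExponent P Q Y) :
    2 * Q - 1 = NormedSpace.exp (Complex.I • Y) * NormedSpace.exp (Complex.I • Y) *
      (2 * P - 1) := by
  rw [mul_assoc, ← symmetry_mul_exp_neg hP h.codiagonal_left, ← h.conj_eq,
    sub_mul, mul_sub, one_mul, exp_I_smul_mul_exp_neg]
  noncomm_ring

theorem exp_sq (hP : P * P = P) (h : IsGeodesicExponent P Q Y) :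
    NormedSpace.exp (Complex.I • Y) * NormedSpace.exp (Complex.I • Y) =
      (2 * Q - 1) * (2 * P - 1) := by
  have h1 : (2 * P - 1) * (2 * P - 1) = 1 := by
    have : (2 * P - 1) * (2 * P - 1) = 4 * (P * P) - 4 * P + 1 := by noncomm_ring
    rw [this, hP]; simp
  rw [h.symmetry_eq hP, mul_assoc _ (2 * P - 1), h1, mul_one]

theorem exp_neg_sq (hP : P * P = P) (hPs : IsSelfAdjoint P) (hQs : IsSelfAdjoint Q)
    (h : IsGeodesicExponent P Q Y) :
    NormedSpace.exp (-(Complex.I • Y)) * NormedSpace.exp (-(Complex.I • Y)) =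
      (2 * P - 1) * (2 * Q - 1) := by
  have h1 := congrArg star (h.exp_sq hP)
  simp only [star_mul, star_sub, star_one, star_ofNat, hPs.star_eq, hQs.star_eq,
    star_exp_I_smul h.isSelfAdjoint] at h1
  rw [h1]
  noncomm_ring

theorem spectrum_subset (h : IsGeodesicExponent P Q Y) {t : ℝ} (ht : t ∈ spectrum ℝ Y) :
    t ∈ Set.Icc (-(Real.pi / 2)) (Real.pi / 2) := by
  have h1 := spectrum.norm_le_norm_mul_of_mem ht
  rw [h.norm_eq] at h1
  -- Only an inequality, as equality fails on the zero space.
  have h2 : ‖(1 : H →L[ℂ] H)‖ ≤ 1 := ContinuousLinearMap.norm_id_le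
  have h3 : |t| ≤ Real.pi / 2 := by
    rw [← Real.norm_eq_abs]
    nlinarith [Real.pi_pos]
  exact abs_le.mp h3

theorem cfc_arcsin_sin (h : IsGeodesicExponent P Q Y) :
    cfc Real.arcsin (cfc Real.sin Y) = Y := by
  have hY := h.isSelfAdjoint
  rw [← cfc_comp' Real.arcsin Real.sin Y (Real.continuous_arcsin.continuousOn)
    (Real.continuous_sin.continuousOn)]
  conv_rhs => rw [← cfc_id ℝ Y]
  refine cfc_congr fun t ht => ?_
  exact Real.arcsin_sin (h.spectrum_subset ht).1 (h.spectrum_subset ht).2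

theorem cos_nonneg (h : IsGeodesicExponent P Q Y) : 0 ≤ cfc Real.cos Y :=
  cfc_nonneg fun _ ht =>
    Real.cos_nonneg_of_neg_pi_div_two_le_of_le (h.spectrum_subset ht).1 (h.spectrum_subset ht).2

/-- `(2 cos Y)² = e^{2iY} + e^{-2iY} + 2`, and the right side depends on `P` and `Q` alone. The next
lemma does the same for `cos Y sin Y`. -/
theorem four_smul_cos_sq (hP : P * P = P) (hPs : IsSelfAdjoint P) (hQs : IsSelfAdjoint Q)
    (h : IsGeodesicExponent P Q Y) : (4 : ℂ) • (cfc Real.cos Y * cfc Real.cos Y) =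
      (2 * Q - 1) * (2 * P - 1) + (2 * P - 1) * (2 * Q - 1) + 2 := by
  have h1 : (4 : ℂ) • (cfc Real.cos Y * cfc Real.cos Y) =
      ((2 : ℂ) • cfc Real.cos Y) * ((2 : ℂ) • cfc Real.cos Y) := by
    rw [smul_mul_smul_comm]; norm_num
  rw [h1, two_smul_cos_eq h.isSelfAdjoint, ← h.exp_sq hP, ← h.exp_neg_sq hP hPs hQs, add_mul,
    mul_add, mul_add, exp_I_smul_mul_exp_neg, exp_neg_mul_exp_I_smul]
  rw [show (2 : H →L[ℂ] H) = 1 + 1 from one_add_one_eq_two.symm]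
  abel

theorem four_I_smul_cos_mul_sin (hP : P * P = P) (hPs : IsSelfAdjoint P) (hQs : IsSelfAdjoint Q)
    (h : IsGeodesicExponent P Q Y) :
    (4 * Complex.I) • (cfc Real.cos Y * cfc Real.sin Y) =
      (2 * Q - 1) * (2 * P - 1) - (2 * P - 1) * (2 * Q - 1) := by
  have h1 : (4 * Complex.I) • (cfc Real.cos Y * cfc Real.sin Y) =
      ((2 : ℂ) • cfc Real.cos Y) * ((2 * Complex.I) • cfc Real.sin Y) := by
    rw [smul_mul_smul_comm]; congr 1; ring
  rw [h1, two_smul_cos_eq h.isSelfAdjoint, two_I_smul_sin_eq h.isSelfAdjoint, ← h.exp_sq hP,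
    ← h.exp_neg_sq hP hPs hQs, add_mul,
    mul_sub, mul_sub, exp_I_smul_mul_exp_neg, exp_neg_mul_exp_I_smul]
  abel

/-- If `cos Y x = 0`, then `QPx = e^{iY} cos Y Px = 0` puts `Px` in `R(P) ∩ N(Q)`, so `Px = 0`. The
same computation with `1 - P` and `1 - Q` then puts `x` in `R(Q) ∩ N(P)`. -/
theorem ker_cos (hP : P * P = P) (h : IsGeodesicExponent P Q Y)
    (h1 : ∀ x, P x = x → Q x = 0 → x = 0) (h2 : ∀ x, Q x = x → P x = 0 → x = 0) {x : H}
    (hx : cfc Real.cos Y x = 0) : x = 0 := by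
  have hY := h.isSelfAdjoint
  have hPc := proj_mul_cos hP hY h.codiagonal_left
  have hcomm : cfc Real.cos Y (P x) = 0 := by
    change (cfc Real.cos Y * P) x = 0
    rw [← hPc]
    change P (cfc Real.cos Y x) = 0
    rw [hx, map_zero]
  have hPP : ∀ y, P (P y) = P y := fun y => congrArg (· y) hP
  have hpx : P x = 0 := by
    refine h1 _ (hPP x) ?_
    change (Q * P) x = 0
    rw [h.mul_eq hP]
    change NormedSpace.exp (Complex.I • Y) (cfc Real.cos Y (P x)) = 0
    rw [hcomm, map_zero]
  refine h2 x ?_ hpx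
  have hq : ((1 - Q) * (1 - P)) x = 0 := by
    have hsin := sin_mul_proj hP hY h.codiagonal_left
    have hQ : 1 - Q = NormedSpace.exp (Complex.I • Y) * (1 - P) *
        NormedSpace.exp (-(Complex.I • Y)) := by
      rw [← h.conj_eq, mul_sub, sub_mul, mul_one, exp_I_smul_mul_exp_neg]
    have h3 : (1 - P) * cfc Real.sin Y * (1 - P) = 0 := by
      rw [← hsin, mul_assoc, mul_sub, mul_one, hP, sub_self, mul_zero]
    have h4 : (1 - P) * cfc Real.cos Y * (1 - P) = (1 - P) * cfc Real.cos Y := by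
      rw [mul_assoc, mul_sub, mul_one, ← hPc, mul_sub, ← mul_assoc (1 - P) P, sub_mul 1 P P, one_mul,
        hP, sub_self, zero_mul, sub_zero]
    have h5 : (1 - Q) * (1 - P) = NormedSpace.exp (Complex.I • Y) *
        ((1 - P) * cfc Real.cos Y) := by
      rw [hQ, exp_neg_I_smul_eq_cos_sub_sin hY, mul_assoc, mul_assoc, ← mul_assoc (1 - P),
        mul_sub (1 - P), sub_mul _ _ (1 - P), mul_smul_comm, smul_mul_assoc, h3, h4, smul_zero,
        sub_zero]
    rw [h5]
    change NormedSpace.exp (Complex.I • Y) ((1 - P) (cfc Real.cos Y x)) = 0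
    rw [hx, map_zero, map_zero]
  have hq2 : (1 - P) x - Q ((1 - P) x) = 0 := hq
  have hq3 : (1 - P) x = x := by
    change x - P x = x
    rw [hpx, sub_zero]
  rw [hq3] at hq2
  exact (sub_eq_zero.mp hq2).symm

/-- `cos Y` is the nonnegative square root of an operator fixed by `P` and `Q`; injectivity allows
it to be cancelled from `cos Y sin Y`, and the arcsine recovers `Y`. -/
theorem unique (hP : P * P = P) (hPs : IsSelfAdjoint P) (hQs : IsSelfAdjoint Q) {Z : H →L[ℂ] H}
    (h1 : ∀ x, P x = x → Q x = 0 → x = 0) (h2 : ∀ x, Q x = x → P x = 0 → x = 0)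
    (h : IsGeodesicExponent P Q Y) (h' : IsGeodesicExponent P Q Z) : Y = Z := by
  have hc2 : cfc Real.cos Y * cfc Real.cos Y = cfc Real.cos Z * cfc Real.cos Z := by
    refine smul_right_injective _ (by norm_num : (4 : ℂ) ≠ 0) ?_
    simp only
    rw [h.four_smul_cos_sq hP hPs hQs, h'.four_smul_cos_sq hP hPs hQs]
  have hc : cfc Real.cos Y = cfc Real.cos Z := by
    rw [← CFC.sqrt_mul_self _ h.cos_nonneg, hc2, CFC.sqrt_mul_self _ h'.cos_nonneg]
  have hcs : cfc Real.cos Y * cfc Real.sin Y = cfc Real.cos Y * cfc Real.sin Z := by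
    refine smul_right_injective _ (mul_ne_zero (by norm_num : (4 : ℂ) ≠ 0) Complex.I_ne_zero) ?_
    simp only
    rw [h.four_I_smul_cos_mul_sin hP hPs hQs, hc, h'.four_I_smul_cos_mul_sin hP hPs hQs]
  have hs : cfc Real.sin Y = cfc Real.sin Z := by
    ext x
    rw [← sub_eq_zero]
    refine h.ker_cos hP h1 h2 ?_
    rw [map_sub, sub_eq_zero]
    exact congrArg (· x) hcs
  rw [← h.cfc_arcsin_sin, hs, h'.cfc_arcsin_sin]

/-- `cos Y P = e^{-iY} QP` is compact, but `cos Y (1 - P)` need not be, since `Y` may vanish on an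
infinite-dimensional `N(P) ∩ N(Q)`. The sine repairs this: it intertwines `P` with `1 - P`, so `cos
Y sin²Y (1 - P) = sin Y (cos Y P) sin Y`. -/
theorem isCompactOperator_sin (hP : P * P = P) (h : IsGeodesicExponent P Q Y)
    (hc : IsCompactOperator (Q * P : H →L[ℂ] H)) :
    IsCompactOperator (cfc Real.sin Y ^ 2 - cfc Real.sin Y ^ 4 : H →L[ℂ] H) := by
  have hY := h.isSelfAdjoint
  set S := cfc Real.sin Y with hS
  set C := cfc Real.cos Y with hC
  have hCS : C * S = S * C := (cfc_commute_cfc Real.cos Real.sin Y).eq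
  have hsin : S * P = (1 - P) * S := sin_mul_proj hP hY h.codiagonal_left
  have hPS : P * S = S * (1 - P) := by
    rw [mul_sub, hsin]; noncomm_ring
  have hCP : IsCompactOperator (C * P : H →L[ℂ] H) := by
    have h1 : C * P = NormedSpace.exp (-(Complex.I • Y)) * (Q * P) := by
      rw [h.mul_eq hP, ← mul_assoc, exp_neg_mul_exp_I_smul, one_mul]
    rw [h1]
    exact hc.clm_comp (NormedSpace.exp (-(Complex.I • Y)))
  have h2 : S ^ 2 + C ^ 2 = 1 := by
    rw [← cfc_pow Real.sin 2 Y, ← cfc_pow Real.cos 2 Y, ← cfc_add (a := Y) _ _]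
    simp only [Real.sin_sq_add_cos_sq]
    exact cfc_const_one ℝ Y
  have h3 : S ^ 2 - S ^ 4 = C * (S * (S * (C * P)) + S * (C * P) * S) := by
    have e1 : S * (C * P) * S = C * S * S * (1 - P) := by
      rw [← mul_assoc S, ← hCS, mul_assoc _ P, hPS]; noncomm_ring
    have e2 : S * (S * (C * P)) = C * S * S * P := by
      rw [← mul_assoc S C, ← hCS, ← mul_assoc, ← mul_assoc, ← hCS]
    rw [e1, e2, ← mul_add, add_sub_cancel, mul_one, mul_assoc C S S, ← mul_assoc C C,
      ← pow_two, ← pow_two, eq_sub_of_add_eq' h2, sub_mul, one_mul, ← pow_add]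
  rw [h3]
  have k1 : IsCompactOperator (S * (S * (C * P)) : H →L[ℂ] H) :=
    (hCP.clm_comp S).clm_comp S
  have k2 : IsCompactOperator (S * (C * P) * S : H →L[ℂ] H) :=
    (hCP.clm_comp S).comp_clm S
  exact (k1.add k2).clm_comp C

/-- `Y = arcsin(sin Y)`, so eigenvectors of `sin Y` are eigenvectors of `Y`. The sine is used
because the cosine forgets the sign of an eigenvalue. -/
theorem eq_zero_of_inner_eigenvector (hP : P * P = P) (h : IsGeodesicExponent P Q Y)
    (hc : IsCompactOperator (Q * P : H →L[ℂ] H)) {x : H}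
    (hx : ∀ (μ : ℝ) (v : H), Y v = (μ : ℂ) • v → inner ℂ v x = 0) : x = 0 := by
  refine eq_zero_of_inner_eigenvector_of_sq_sub_pow_four (S := cfc Real.sin Y) (cfc_predicate _ _)
    (h.isCompactOperator_sin hP hc) fun μ v hv => hx (Real.arcsin μ) v ?_
  have h1 := cfc_apply_eigenvector (cfc_predicate Real.sin Y) hv Real.continuous_arcsin
  rwa [h.cfc_arcsin_sin] at h1

end IsGeodesicExponent

end Geodesic

/-! ### Eigenvalue sums and the geodesic exponent -/

section EigenvalueSums

variable {H : Type*} [NormedAddCommGroup H] [InnerProductSpace ℂ H] [CompleteSpace H]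

theorem enorm_ofReal_smul_sq (r : ℝ) (v : H) :
    ‖(r : ℂ) • v‖ₑ ^ 2 = ENNReal.ofReal (r ^ 2 * ‖v‖ ^ 2) := by
  rw [← ofReal_norm, ← ENNReal.ofReal_pow (norm_nonneg _), norm_smul, Complex.norm_real, mul_pow,
    Real.norm_eq_abs, sq_abs]

theorem IsEigenbasis.hsNorm_opCos_sq {T : H →L[ℂ] H} (hT : IsSelfAdjoint T) {ι : Type*}
    {b : HilbertBasis ι ℂ H} {γ : ι → ℝ} (hb : IsEigenbasis T b γ) :
    hsNorm (opCos T) ^ 2 = ∑' i, ENNReal.ofReal (Real.cos (γ i) ^ 2) := by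
  rw [hsNorm_sq b]
  refine tsum_congr fun i => ?_
  rw [opCos, cfc_apply_eigenvector hT (hb i) Real.continuous_cos, enorm_ofReal_smul_sq,
    b.orthonormal.1 i]
  simp

theorem EigenvalueSumEq.rpow_eq {T : H →L[ℂ] H} (hT : IsSelfAdjoint T) {s : ℝ≥0∞}
    (h : EigenvalueSumEq T (fun γ => 1 / 2 * Real.cos γ ^ 2) s) :
    s ^ (1 / 2 : ℝ) = ENNReal.ofReal (1 / √2) * hsNorm (opCos T) := by
  obtain ⟨⟨ι, b, γ, hb⟩, h2⟩ := h
  have h3 := h2 ι b γ hb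
  have h4 : s = ENNReal.ofReal (1 / 2) * hsNorm (opCos T) ^ 2 := by
    rw [hb.hsNorm_opCos_sq hT, ← h3, ← ENNReal.tsum_mul_left]
    refine tsum_congr fun i => ?_
    rw [← ENNReal.ofReal_mul (by norm_num)]
  rw [h4, ENNReal.mul_rpow_of_nonneg _ _ (by norm_num), ← ENNReal.rpow_natCast,
    ← ENNReal.rpow_mul, ENNReal.ofReal_rpow_of_pos (by norm_num), ← Real.sqrt_eq_rpow]
  norm_num

end EigenvalueSums

section Codiagonal

variable {H : Type*} [NormedAddCommGroup H] [InnerProductSpace ℂ H] [CompleteSpace H]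

/-- A projection halves the squared norm of an eigenvector of a co-diagonal operator. -/
theorem IsCodiagonal.norm_sq_apply_eigenvector {P Y : H →L[ℂ] H} (h : IsCodiagonal P Y)
    (hP : P * P = P) (hPs : IsSelfAdjoint P) (hY : IsSelfAdjoint Y) {μ : ℝ} (hμ : μ ≠ 0) {v : H}
    (hv : Y v = (μ : ℂ) • v) : ‖P v‖ ^ 2 = 1 / 2 * ‖v‖ ^ 2 := by
  have hPsym : ∀ a b, inner ℂ (P a) b = inner ℂ a (P b) := hPs.isSymmetric
  have hYsym : ∀ a b, inner ℂ (Y a) b = inner ℂ a (Y b) := hY.isSymmetric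
  have h1 : P (Y v) + Y (P v) = Y v := congrArg (· v) h.add_eq
  -- The two sides equal `μ(‖v‖² - ‖Pv‖²)` and `μ‖Pv‖²`.
  have h2 : inner ℂ (Y (P v)) v = inner ℂ (P v) (Y v) := hYsym _ _
  have h3 : Y (P v) = (μ : ℂ) • (v - P v) := by
    rw [eq_sub_of_add_eq' h1, hv, map_smul, smul_sub]
  rw [h3, hv, inner_smul_left, inner_smul_right, Complex.conj_ofReal, inner_sub_left] at h2
  have h4 := mul_left_cancel₀ (Complex.ofReal_ne_zero.mpr hμ) h2
  have h5 : inner ℂ (P v) v = inner ℂ (P v) (P v) := by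
    rw [hPsym v (P v), show P (P v) = P v from congrArg (· v) hP, hPsym]
  rw [h5, inner_self_eq_norm_sq_to_K, inner_self_eq_norm_sq_to_K] at h4
  have h6 : ‖v‖ ^ 2 - ‖P v‖ ^ 2 = ‖P v‖ ^ 2 := by exact_mod_cast h4
  linarith

end Codiagonal

namespace IsGeodesicExponent

variable {H : Type*} [NormedAddCommGroup H] [InnerProductSpace ℂ H] [CompleteSpace H]
variable {P Q Y : H →L[ℂ] H}

theorem apply_eigenvector (hP : P * P = P) (h : IsGeodesicExponent P Q Y) {μ : ℝ} {v : H}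
    (hv : Y v = (μ : ℂ) • v) :
    Q (P v) = (Real.cos μ : ℂ) • NormedSpace.exp (Complex.I • Y) (P v) := by
  change (Q * P) v = _
  rw [h.mul_eq hP, ← proj_mul_cos hP h.isSelfAdjoint h.codiagonal_left]
  change NormedSpace.exp (Complex.I • Y) (P (cfc Real.cos Y v)) = _
  rw [cfc_apply_eigenvector h.isSelfAdjoint hv Real.continuous_cos, map_smul, map_smul]

/-- `Y` kills `Py` as well, so `e^{iY}` fixes it and `QPy = Py` lies in both ranges. -/
theorem mul_apply_eq_zero_of_ker (hP : P * P = P) (h : IsGeodesicExponent P Q Y)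
    (hPQ : ∀ x, P x = x → Q x = x → x = 0) {y : H} (hy : Y y = 0) : Q (P y) = 0 := by
  have h1 : Y (P y) = 0 := by
    have : P (Y y) + Y (P y) = Y y := congrArg (· y) h.codiagonal_left.add_eq
    simpa [hy] using this
  have h0 : Y y = ((0 : ℝ) : ℂ) • y := by simp [hy]
  have h01 : Y (P y) = ((0 : ℝ) : ℂ) • P y := by simp [h1]
  have h2 : Q (P y) = P y := by
    rw [h.apply_eigenvector hP h0, exp_I_smul_apply_eigenvector h.isSelfAdjoint h01]
    simp
  rw [h2]
  exact hPQ _ (congrArg (· y) hP) h2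

theorem isSelfAdjoint_restrictKerPerp (hY : IsSelfAdjoint Y) :
    IsSelfAdjoint (restrictKerPerp Y hY) := by
  rw [ContinuousLinearMap.isSelfAdjoint_iff_isSymmetric]
  intro a b
  exact hY.isSymmetric (a : H) (b : H)

theorem exists_isEigenbasis {H : Type} [NormedAddCommGroup H] [InnerProductSpace ℂ H]
    [CompleteSpace H] {P Q Y : H →L[ℂ] H} (hP : P * P = P) (h : IsGeodesicExponent P Q Y)
    (hc : IsCompactOperator (Q * P : H →L[ℂ] H)) :
    ∃ (ι : Type) (b : HilbertBasis ι ℂ _) (γ : ι → ℝ),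
      IsEigenbasis (restrictKerPerp Y h.isSelfAdjoint) b γ := by
  refine _root_.exists_isEigenbasis (isSelfAdjoint_restrictKerPerp h.isSelfAdjoint) fun x hx => ?_
  refine Subtype.ext (h.eq_zero_of_inner_eigenvector hP hc fun μ v hv => ?_)
  by_cases hμ : μ = 0
  · have hv0 : v ∈ LinearMap.ker Y.toLinearMap := by
      simpa [hμ] using hv
    exact Submodule.inner_right_of_mem_orthogonal hv0 x.2
  · have hv0 : v ∈ (LinearMap.ker Y.toLinearMap)ᗮ := by
      rw [Submodule.mem_orthogonal]
      intro u hu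
      have hu' : Y u = 0 := hu
      have h1 : inner ℂ (Y u) v = inner ℂ u (Y v) := h.isSelfAdjoint.isSymmetric u v
      rw [hu', inner_zero_left, hv, inner_smul_right] at h1
      exact (mul_eq_zero.mp h1.symm).resolve_left (Complex.ofReal_ne_zero.mpr hμ)
    exact hx μ ⟨v, hv0⟩ (Subtype.ext hv)

/-- A basis vector `v` contributes `‖QPv‖² = cos²γ ‖Pv‖² = cos²γ / 2`. The complement `N(Y)`
contributes nothing, so the sum is the full squared norm of `QP`. -/
theorem tsum_half_cos_sq (hP : P * P = P) (hPs : IsSelfAdjoint P)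
    (h : IsGeodesicExponent P Q Y) (hPQ : ∀ x, P x = x → Q x = x → x = 0) {ι : Type*}
    {b : HilbertBasis ι ℂ (LinearMap.ker Y.toLinearMap)ᗮ} {γ : ι → ℝ}
    (hb : IsEigenbasis (restrictKerPerp Y h.isSelfAdjoint) b γ) :
    ∑' i, ENNReal.ofReal (1 / 2 * Real.cos (γ i) ^ 2) = hsNorm (Q * P) ^ 2 := by
  rw [← tsum_enorm_sq_comp_isometry b (LinearMap.ker Y.toLinearMap)ᗮ.subtypeₗᵢ (Q * P)]
  · refine tsum_congr fun i => ?_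
    have hv : Y (b i : H) = (γ i : ℂ) • (b i : H) := congrArg Subtype.val (hb i)
    have hb1 : ‖(b i : H)‖ = 1 := b.orthonormal.1 i
    have hγ : γ i ≠ 0 := by
      intro h0
      have h1 : (b i : H) ∈ LinearMap.ker Y.toLinearMap := by
        simpa [h0] using hv
      have h2 := Submodule.inner_right_of_mem_orthogonal h1 (b i).2
      rw [inner_self_eq_zero] at h2
      simp [h2] at hb1
    change _ = ‖Q (P (b i : H))‖ₑ ^ 2
    rw [h.apply_eigenvector hP hv, enorm_ofReal_smul_sq, norm_exp_I_smul_apply h.isSelfAdjoint,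
      h.codiagonal_left.norm_sq_apply_eigenvector hP hPs h.isSelfAdjoint hγ hv, hb1]
    ring_nf
  · intro y hy
    refine h.mul_apply_eq_zero_of_ker hP hPQ ?_
    have h1 : y ∈ (LinearMap.ker Y.toLinearMap)ᗮᗮ := by
      rw [Submodule.mem_orthogonal]
      exact fun u hu => hy ⟨u, hu⟩
    have hcl : IsClosed (LinearMap.ker Y.toLinearMap : Set H) := Y.isClosed_ker
    rw [Submodule.orthogonal_orthogonal_eq_closure,
      hcl.submodule_topologicalClosure_eq] at h1
    exact h1

theorem eigenvalueSumEq {H : Type} [NormedAddCommGroup H] [InnerProductSpace ℂ H]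
    [CompleteSpace H] {P Q Y : H →L[ℂ] H} (hP : P * P = P) (hPs : IsSelfAdjoint P)
    (h : IsGeodesicExponent P Q Y) (hPQ : ∀ x, P x = x → Q x = x → x = 0) {s : ℝ≥0∞}
    (hs : hsNorm (Q * P) ^ 2 = s) (hs_fin : s ≠ ∞) :
    EigenvalueSumEq (restrictKerPerp Y h.isSelfAdjoint) (fun γ => 1 / 2 * Real.cos γ ^ 2) s :=
  ⟨h.exists_isEigenbasis hP (isCompactOperator_of_hsNorm_ne_top _
    fun h0 => hs_fin (by rw [← hs, h0]; simp)),
    fun _ _ _ hb => hs ▸ h.tsum_half_cos_sq hP hPs hPQ hb⟩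

end IsGeodesicExponent

/-! ### The projections `P_I`, `Q_J` and the norm of their product -/

section Fourier

open scoped SchwartzMap

variable {n : ℕ}

theorem coeFn_projP (I : Set (Rn n)) (hI : NullMeasurableSet I volume) (f : L2Rn n) :
    projP I hI f =ᵐ[volume] I.indicator f :=
  (memLp_indicator_of_nullMeasurableSet hI f).coeFn_toLp

/-- On integrable functions the Fourier-Plancherel transform is given by the Fourier integral. -/
theorem coeFn_fourierU_of_integrable (f : L2Rn n) (hf : Integrable (f : Rn n → ℂ) volume) :
    fourierU n f =ᵐ[volume] 𝓕 (f : Rn n → ℂ) := by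
  have hL : Continuous fun p : Rn n × Rn n => (innerₗ (Rn n) p.1) p.2 := continuous_inner
  have hcont : Continuous (𝓕 (f : Rn n → ℂ)) :=
    VectorFourier.fourierIntegral_continuous Real.continuous_fourierChar hL hf
  -- Both functions are tested against smooth compactly supported `g`; on each side the transform
  -- moves onto `g`, by duality of distributions and by Fubini respectively.
  refine ae_eq_of_integral_contDiff_smul_eq
    ((Lp.memLp _).locallyIntegrable (by norm_num)) hcont.locallyIntegrable fun g hg hgc => ?_
  have hgc' : HasCompactSupport fun x => (g x : ℂ) := hgc.comp_left (g := Complex.ofReal) rfl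
  have hg' : ContDiff ℝ ((⊤ : ℕ∞) : WithTop ℕ∞) fun x => (g x : ℂ) := Complex.ofRealCLM.contDiff.comp hg
  let G : 𝓢(Rn n, ℂ) := hgc'.toSchwartzMap hg'
  have hG : ∀ x, G x = (g x : ℂ) := fun _ => rfl
  have h1 := congrArg (· G) (Lp.fourier_toTemperedDistribution_eq f)
  simp only [TemperedDistribution.fourier_apply, Lp.toTemperedDistribution_apply] at h1
  have h2 := VectorFourier.integral_fourierIntegral_smul_eq_flip (L := innerₗ (Rn n))
    (μ := volume) (ν := volume) Real.continuous_fourierChar hL G.integrable hf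
  have h3 : (innerₗ (Rn n)).flip = innerₗ (Rn n) := by
    exact LinearMap.ext fun x => LinearMap.ext fun y => real_inner_comm x y
  rw [h3] at h2
  have h4 : ∫ x, G x • (𝓕 f : L2Rn n) x = ∫ x, G x • 𝓕 (f : Rn n → ℂ) x := by
    rw [← h1, SchwartzMap.fourier_coe]
    exact h2
  simpa only [hG, Complex.coe_smul] using! h4

theorem integrable_of_projP_eq {I : Set (Rn n)} {hI : NullMeasurableSet I volume}
    (hI_fin : volume I ≠ ∞) {f : L2Rn n} (hf : projP I hI f = f) :
    Integrable (f : Rn n → ℂ) volume := by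
  have h1 : (f : Rn n → ℂ) =ᵐ[volume] I.indicator f := by
    have := coeFn_projP I hI f
    rwa [hf] at this
  rw [integrable_congr h1]
  refine IntegrableOn.integrable_indicator₀ ?_ hI
  have : IsFiniteMeasure (volume.restrict I) := ⟨by simpa using hI_fin.lt_top⟩
  exact ((Lp.memLp f).restrict I).integrable (by norm_num)

theorem enorm_projP_sq (J : Set (Rn n)) (hJ : NullMeasurableSet J volume) (f : L2Rn n) :
    ‖projP J hJ f‖ₑ ^ 2 = ∫⁻ x in J, ‖f x‖ₑ ^ 2 := by
  have h := eLpNorm_nnreal_pow_eq_lintegral (μ := volume) (f := (projP J hJ f : Rn n → ℂ))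
    (two_ne_zero (α := NNReal))
  rw [Lp.enorm_def, ← lintegral_indicator₀ hJ]
  have h2 : eLpNorm (projP J hJ f : Rn n → ℂ) 2 volume ^ 2 =
      ∫⁻ x, ‖projP J hJ f x‖ₑ ^ 2 := by
    simpa using h
  rw [h2]
  refine lintegral_congr_ae ?_
  filter_upwards [coeFn_projP J hJ f] with x hx
  rw [hx]
  by_cases h : x ∈ J <;> simp [h]

theorem projP_mul_self (I : Set (Rn n)) (hI : NullMeasurableSet I volume) :
    projP I hI * projP I hI = projP I hI := by
  ext1 f
  change projP I hI (projP I hI f) = projP I hI f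
  refine Lp.ext ?_
  filter_upwards [coeFn_projP I hI (projP I hI f), coeFn_projP I hI f] with x h1 h2
  rw [h1, h2]
  by_cases h : x ∈ I <;> simp [h, h2]

theorem isSelfAdjoint_projP (I : Set (Rn n)) (hI : NullMeasurableSet I volume) :
    IsSelfAdjoint (projP I hI) := by
  rw [ContinuousLinearMap.isSelfAdjoint_iff_isSymmetric]
  intro f g
  change inner ℂ (projP I hI f) g = inner ℂ f (projP I hI g)
  rw [L2.inner_def, L2.inner_def]
  refine integral_congr_ae ?_
  filter_upwards [coeFn_projP I hI f, coeFn_projP I hI g] with x h1 h2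
  rw [h1, h2]
  by_cases h : x ∈ I <;> simp [h]

theorem projQ_apply (J : Set (Rn n)) (hJ : NullMeasurableSet J volume) (f : L2Rn n) :
    projQ J hJ f = (fourierU n).symm (projP J hJ (fourierU n f)) := rfl

theorem fourierU_projQ (J : Set (Rn n)) (hJ : NullMeasurableSet J volume) (f : L2Rn n) :
    fourierU n (projQ J hJ f) = projP J hJ (fourierU n f) := by
  rw [projQ_apply, LinearIsometryEquiv.apply_symm_apply]

theorem projQ_mul_self (J : Set (Rn n)) (hJ : NullMeasurableSet J volume) :
    projQ J hJ * projQ J hJ = projQ J hJ := by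
  ext1 f
  change projQ J hJ (projQ J hJ f) = projQ J hJ f
  apply (fourierU n).injective
  rw [fourierU_projQ, fourierU_projQ]
  exact congrArg (· (fourierU n f)) (projP_mul_self J hJ)

theorem isSelfAdjoint_projQ (J : Set (Rn n)) (hJ : NullMeasurableSet J volume) :
    IsSelfAdjoint (projQ J hJ) := by
  rw [ContinuousLinearMap.isSelfAdjoint_iff_isSymmetric]
  intro f g
  change inner ℂ (projQ J hJ f) g = inner ℂ f (projQ J hJ g)
  rw [← (fourierU n).inner_map_map, ← (fourierU n).inner_map_map f, fourierU_projQ,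
    fourierU_projQ]
  exact (isSelfAdjoint_projP J hJ).isSymmetric (fourierU n f) (fourierU n g)

/-- Basis vectors are `√2` apart, so the balls of radius `1/2` are disjoint. Countability permits
exchanging the basis sum with an integral. -/
theorem HilbertBasis.countable {H : Type*} [NormedAddCommGroup H] [InnerProductSpace ℂ H]
    [SecondCountableTopology H] {ι : Type*} (b : HilbertBasis ι ℂ H) : Countable ι := by
  have hd : (Set.univ : Set ι).PairwiseDisjoint fun i => Metric.ball (b i) (1 / 2) := by
    intro i _ j _ hij
    refine Metric.ball_disjoint_ball ?_
    have h1 : ‖b i - b j‖ ^ 2 = 2 := by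
      rw [@norm_sub_sq ℂ, b.orthonormal.1 i, b.orthonormal.1 j, b.orthonormal.2 hij]
      norm_num
    rw [dist_eq_norm]
    nlinarith [norm_nonneg (b i - b j)]
  have h := hd.countable_of_isOpen (fun i _ => Metric.isOpen_ball)
    (fun i _ => ⟨b i, Metric.mem_ball_self (by norm_num)⟩)
  exact Set.countable_univ_iff.mp h

/-- The transform at `ξ` is the inner product of `b i` with `g = χ_I e^{2πi⟨·, ξ⟩}`, and Parseval
returns `‖g‖² = |I|`. -/
theorem tsum_enorm_fourier_sq {I : Set (Rn n)} (hI : NullMeasurableSet I volume)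
    (hI_fin : volume I ≠ ∞) {ι : Type*} (b : HilbertBasis ι ℂ (L2Rn n)) (ξ : Rn n) :
    ∑' i, ‖𝓕 (projP I hI (b i) : Rn n → ℂ) ξ‖ₑ ^ 2 = volume I := by
  have hcont : Continuous fun x : Rn n => ((Real.fourierChar (inner ℝ x ξ) : Circle) : ℂ) :=
    continuous_induced_dom.comp
      (Real.continuous_fourierChar.comp (continuous_id.inner continuous_const))
  let g : Rn n → ℂ := I.indicator fun x => ((Real.fourierChar (inner ℝ x ξ) : Circle) : ℂ)
  have hgn : ∀ x, ‖g x‖ₑ ^ 2 = I.indicator (fun _ => (1 : ℝ≥0∞)) x := by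
    intro x
    by_cases h : x ∈ I
    · simp only [g, h, Set.indicator_of_mem, ← ofReal_norm, Circle.norm_coe]
      simp
    · simp [g, h]
  have hg : MemLp g 2 volume := by
    refine ⟨hcont.aestronglyMeasurable.indicator₀ hI, ?_⟩
    have h1 := eLpNorm_nnreal_pow_eq_lintegral (μ := volume) (f := g) (two_ne_zero (α := NNReal))
    have h2 : eLpNorm g 2 volume ^ 2 = volume I := by
      rw [← lintegral_indicator_one₀ hI]
      exact (by simpa using h1 : _ = ∫⁻ x, ‖g x‖ₑ ^ 2).trans (lintegral_congr hgn)
    exact lt_top_iff_ne_top.mpr fun h3 => hI_fin (by rw [← h2, h3]; simp)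
  have h1 : ∀ i, 𝓕 (projP I hI (b i) : Rn n → ℂ) ξ = inner ℂ (hg.toLp g) (b i) := by
    intro i
    rw [Real.fourier_eq, L2.inner_def]
    refine integral_congr_ae ?_
    filter_upwards [coeFn_projP I hI (b i), hg.coeFn_toLp] with x h1 h2
    rw [h1, h2]
    by_cases h : x ∈ I
    · simp only [h, Set.indicator_of_mem, g, RCLike.inner_apply, Circle.smul_def, smul_eq_mul]
      rw [AddChar.map_neg_eq_inv, Circle.coe_inv_eq_conj, mul_comm]
    · simp [h, g]
  simp_rw [h1]
  have h2 : ∀ i, ‖inner ℂ (hg.toLp g) (b i)‖ₑ = ‖inner ℂ (b i) (hg.toLp g)‖ₑ := by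
    intro i
    rw [← inner_conj_symm, RCLike.enorm_conj]
  simp_rw [h2]
  rw [b.tsum_enorm_inner_sq, Lp.enorm_toLp]
  have h3 := eLpNorm_nnreal_pow_eq_lintegral (μ := volume) (f := g) (two_ne_zero (α := NNReal))
  have h4 : eLpNorm g 2 volume ^ 2 = ∫⁻ x, ‖g x‖ₑ ^ 2 := by simpa using h3
  rw [h4]
  simp_rw [hgn]
  rw [lintegral_indicator₀ hI]
  simp

/-- `‖Q_J P_I‖²_HS = |I||J|`. -/
theorem hsNorm_projQ_mul_projP_sq (I J : Set (Rn n)) (hI : NullMeasurableSet I volume)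
    (hJ : NullMeasurableSet J volume) (hI_fin : volume I ≠ ∞) :
    hsNorm (projQ J hJ * projP I hI) ^ 2 = volume I * volume J := by
  have : Fact ((2 : ℝ≥0∞) ≠ ∞) := ⟨by simp⟩
  obtain ⟨w, b, -⟩ := exists_hilbertBasis ℂ (L2Rn n)
  have : Countable w := b.countable
  have hae : ∀ i, fourierU n (projP I hI (b i)) =ᵐ[volume] 𝓕 (projP I hI (b i) : Rn n → ℂ) :=
    fun i => coeFn_fourierU_of_integrable _ (integrable_of_projP_eq (hI := hI) hI_fin
      (congrArg (· (b i)) (projP_mul_self I hI)))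
  have hterm : ∀ i, ‖(projQ J hJ * projP I hI) (b i)‖ₑ ^ 2 =
      ∫⁻ ξ in J, ‖𝓕 (projP I hI (b i) : Rn n → ℂ) ξ‖ₑ ^ 2 := by
    intro i
    change ‖projQ J hJ (projP I hI (b i))‖ₑ ^ 2 = _
    rw [projQ_apply, enorm_eq_iff_norm_eq.mpr ((fourierU n).symm.norm_map _), enorm_projP_sq]
    refine lintegral_congr_ae (ae_restrict_of_ae ?_)
    filter_upwards [hae i] with x hx
    rw [hx]
  rw [hsNorm_sq b]
  simp_rw [hterm]
  -- The integrand summed over the basis is the constant `|I|`, to be integrated over `J`.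
  rw [← lintegral_tsum]
  · simp_rw [tsum_enorm_fourier_sq hI hI_fin b]
    simp
  · intro i
    refine AEMeasurable.restrict ?_
    have h1 : AEMeasurable (fun x => ‖fourierU n (projP I hI (b i)) x‖ₑ ^ 2) volume :=
      ((Lp.aestronglyMeasurable _).enorm).pow_const 2
    refine h1.congr ?_
    filter_upwards [hae i] with x hx
    rw [hx]

end Fourier

/-! ### Modulations and the uncertainty principle -/

section Modulation

variable {n : ℕ}

/-- The character `x ↦ exp(2πi⟨b, x⟩)`. -/
def character (b x : Rn n) : ℂ := ((Real.fourierChar (inner ℝ b x) : Circle) : ℂ)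

theorem norm_character (b x : Rn n) : ‖character b x‖ = 1 := Circle.norm_coe _

theorem continuous_character (b : Rn n) : Continuous (character b) :=
  continuous_induced_dom.comp
    (Real.continuous_fourierChar.comp (continuous_const.inner continuous_id))

theorem character_nsmul (b : Rn n) (k : ℕ) (x : Rn n) :
    character (k • b) x = character b x ^ k := by
  rw [character, character, ← Circle.coe_pow, ← AddChar.map_nsmul_eq_pow]
  congr 2
  rw [← Nat.cast_smul_eq_nsmul ℝ, real_inner_smul_left, nsmul_eq_mul]

theorem memLp_character_mul (b : Rn n) (f : L2Rn n) :
    MemLp (fun x => character b x * f x) 2 volume :=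
  (Lp.memLp f).mono ((continuous_character b).aestronglyMeasurable.mul
    (Lp.aestronglyMeasurable f)) (.of_forall fun x => by rw [norm_mul, norm_character, one_mul])

/-- Modulation by a character. -/
def modulate (b : Rn n) (f : L2Rn n) : L2Rn n := (memLp_character_mul b f).toLp _

theorem coeFn_modulate (b : Rn n) (f : L2Rn n) :
    modulate b f =ᵐ[volume] fun x => character b x * f x :=
  (memLp_character_mul b f).coeFn_toLp

/-- On a nonempty level set `⟨b, x⟩` is determined up to an integer, so the set lies in countably
many translates of the hyperplane orthogonal to `b`. -/
theorem volume_character_eq {b : Rn n} (hb : b ≠ 0) (z : ℂ) :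
    volume {x : Rn n | character b x = z} = 0 := by
  rcases Set.eq_empty_or_nonempty {x : Rn n | character b x = z} with h | ⟨x₀, hx₀⟩
  · rw [h, measure_empty]
  have hne : (ℝ ∙ b)ᗮ ≠ ⊤ := by
    intro h
    rw [Submodule.orthogonal_eq_top_iff, Submodule.span_singleton_eq_bot] at h
    exact hb h
  have h0 := Measure.addHaar_submodule (volume : Measure (Rn n)) (ℝ ∙ b)ᗮ hne
  have hsub : {x : Rn n | character b x = z} ⊆
      ⋃ m : ℤ, (fun x => x - (x₀ + ((m : ℝ) / ‖b‖ ^ 2) • b)) ⁻¹' ((ℝ ∙ b)ᗮ : Set (Rn n)) := by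
    intro x hx
    have h1 : character b x = character b x₀ := hx.trans hx₀.symm
    rw [character, character, Real.fourierChar_apply, Real.fourierChar_apply,
      Complex.exp_eq_exp_iff_exists_int] at h1
    obtain ⟨m, hm⟩ := h1
    have h2 : inner ℝ b x = inner ℝ b x₀ + m := by
      have h3 : ((2 * Real.pi * inner ℝ b x : ℝ) : ℂ) * Complex.I =
          ((2 * Real.pi * (inner ℝ b x₀ + m) : ℝ) : ℂ) * Complex.I := by
        rw [hm]; push_cast; ring
      have h4 := mul_right_cancel₀ Complex.I_ne_zero h3
      have h5 := Complex.ofReal_injective h4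
      exact mul_left_cancel₀ (by positivity) h5
    refine Set.mem_iUnion.mpr ⟨m, ?_⟩
    change x - (x₀ + ((m : ℝ) / ‖b‖ ^ 2) • b) ∈ (ℝ ∙ b)ᗮ
    rw [Submodule.mem_orthogonal_singleton_iff_inner_right, inner_sub_right, inner_add_right,
      inner_smul_right, real_inner_self_eq_norm_sq, h2]
    have : ‖b‖ ≠ 0 := norm_ne_zero_iff.mpr hb
    field_simp
    ring
  refine measure_mono_null hsub (measure_iUnion_null fun m => ?_)
  rw [(measurePreserving_sub_right volume _).measure_preimage
    (Submodule.closed_of_finiteDimensional _).measurableSet.nullMeasurableSet]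
  exact h0

theorem coeFn_sum_smul_modulate (b : Rn n) (f : L2Rn n) (s : Finset ℕ) (c : ℕ → ℂ) :
    (∑ k ∈ s, c k • modulate (k • b) f : L2Rn n) =ᵐ[volume]
      fun x => (∑ k ∈ s, Polynomial.monomial k (c k)).eval (character b x) * f x := by
  classical
  induction s using Finset.induction_on with
  | empty =>
    filter_upwards [Lp.coeFn_zero ℂ 2 (volume : Measure (Rn n))] with x hx
    simp
  | insert a s ha ih =>
    rw [Finset.sum_insert ha, Finset.sum_insert ha]
    filter_upwards [ih, Lp.coeFn_add (c a • modulate (a • b) f)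
      (∑ k ∈ s, c k • modulate (k • b) f), Lp.coeFn_smul (c a) (modulate (a • b) f),
      coeFn_modulate (a • b) f] with x h1 h2 h3 h4
    rw [h2, Pi.add_apply, h1, h3, Pi.smul_apply, h4, Polynomial.eval_add,
      Polynomial.eval_monomial, character_nsmul, smul_eq_mul]
    ring

/-- A relation reads `p(character b x) f(x) = 0` almost everywhere with a nonzero polynomial `p`;
its finitely many roots are attained only on null sets, so `f = 0`. -/
theorem linearIndependent_modulate {b : Rn n} (hb : b ≠ 0) {f : L2Rn n} (hf : f ≠ 0) :
    LinearIndependent ℂ fun k : ℕ => modulate (k • b) f := by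
  rw [linearIndependent_iff']
  intro s c hs k hk
  by_contra hck
  set p : Polynomial ℂ := ∑ k ∈ s, Polynomial.monomial k (c k) with hp
  have hp0 : p ≠ 0 := by
    intro h
    have h1 : p.coeff k = c k := by
      simp [hp, Polynomial.coeff_monomial, hk]
    rw [h, Polynomial.coeff_zero] at h1
    exact hck h1.symm
  have hroot : ∀ᵐ x : Rn n, p.eval (character b x) ≠ 0 := by
    have hsub : {x : Rn n | p.eval (character b x) = 0} ⊆
        ⋃ z ∈ p.roots.toFinset, {x : Rn n | character b x = z} := by
      intro x hx
      simp only [Set.mem_iUnion]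
      exact ⟨character b x, by simpa [hp0] using hx, rfl⟩
    rw [ae_iff]
    simp only [not_not]
    refine measure_mono_null hsub ?_
    exact (measure_biUnion_null_iff p.roots.toFinset.countable_toSet).mpr
      fun z _ => volume_character_eq hb z
  refine hf (Lp.ext ?_)
  have h1 := coeFn_sum_smul_modulate b f s c
  rw [hs] at h1
  filter_upwards [h1, hroot, Lp.coeFn_zero ℂ 2 (volume : Measure (Rn n))] with x h2 h3 h4
  rw [h4] at h2 ⊢
  exact (mul_eq_zero.mp h2.symm).resolve_left h3

theorem projP_modulate {I : Set (Rn n)} {hI : NullMeasurableSet I volume} {f : L2Rn n}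
    (hf : projP I hI f = f) (b : Rn n) : projP I hI (modulate b f) = modulate b f := by
  refine Lp.ext ?_
  have h0 := coeFn_projP I hI f
  rw [hf] at h0
  filter_upwards [coeFn_projP I hI (modulate b f), coeFn_modulate b f, h0] with x h1 h2 h3
  rw [h1]
  by_cases h : x ∈ I
  · simp [h]
  · simp only [h, not_false_eq_true, Set.indicator_of_notMem] at h3 ⊢
    rw [h2, h3, mul_zero]

theorem fourier_character_mul (b : Rn n) (f : Rn n → ℂ) (ξ : Rn n) :
    𝓕 (fun x => character b x * f x) ξ = 𝓕 f (ξ - b) := by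
  rw [Real.fourier_eq, Real.fourier_eq]
  congr 1
  ext x
  rw [Circle.smul_def, Circle.smul_def, smul_eq_mul, smul_eq_mul, ← mul_assoc, character,
    ← Circle.coe_mul, ← AddChar.map_add_eq_mul]
  congr 3
  rw [inner_sub_right, real_inner_comm b x]
  ring

/-- Modulation by `b` translates the Fourier transform by `b`, moving its support from `J` into `K`.
Support in `I`, of finite measure, makes the Fourier integral available pointwise. -/
theorem projQ_modulate {I J K : Set (Rn n)} {hI : NullMeasurableSet I volume}
    {hJ : NullMeasurableSet J volume} (hI_fin : volume I ≠ ∞) {f : L2Rn n}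
    (hf : projP I hI f = f) (hf2 : projQ J hJ f = f) (hK : NullMeasurableSet K volume) {b : Rn n}
    (hJK : ∀ᵐ ξ, ξ ∈ J → ξ + b ∈ K) : projQ K hK (modulate b f) = modulate b f := by
  apply (fourierU n).injective
  rw [fourierU_projQ]
  have h1 := coeFn_fourierU_of_integrable f (integrable_of_projP_eq hI_fin hf)
  have h2 := coeFn_fourierU_of_integrable (modulate b f)
    (integrable_of_projP_eq hI_fin (projP_modulate hf b))
  have h3 : 𝓕 (modulate b f : Rn n → ℂ) = fun ξ => 𝓕 (f : Rn n → ℂ) (ξ - b) := by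
    ext ξ
    rw [← fourier_character_mul, Real.fourier_eq, Real.fourier_eq]
    refine integral_congr_ae ?_
    filter_upwards [coeFn_modulate b f] with x hx
    rw [hx]
  have h4 := coeFn_projP J hJ (fourierU n f)
  rw [← fourierU_projQ, hf2] at h4
  have h5 : ∀ᵐ ξ, ξ ∉ J → 𝓕 (f : Rn n → ℂ) ξ = 0 := by
    filter_upwards [h4, h1] with ξ h6 h7 h8
    rw [← h7, h6]
    simp [h8]
  have h6 := (measurePreserving_sub_right (volume : Measure (Rn n)) b).quasiMeasurePreserving.ae
    (h5.and hJK)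
  refine Lp.ext ?_
  filter_upwards [coeFn_projP K hK (fourierU n (modulate b f)), h2, h6] with ξ h7 h8 h9
  rw [h7]
  by_cases h : ξ ∈ K
  · simp [h]
  · have h10 : ξ - b ∉ J := fun h11 => h (by simpa using h9.2 h11)
    simp only [h, not_false_eq_true, Set.indicator_of_notMem]
    rw [h8, h3]
    exact (h9.1 h10).symm

theorem exists_ne_zero_Rn (hn : 0 < n) : ∃ b : Rn n, b ≠ 0 :=
  ⟨EuclideanSpace.single ⟨0, hn⟩ 1, by simp⟩

/-- The modulations of an indicator function supported in `I` are independent and stay in the range.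
This is what pushes the norm of the exponent up to `π/2`. -/
theorem not_finiteDimensional_range_projP (hn : 0 < n) {I : Set (Rn n)}
    (hI : NullMeasurableSet I volume) (hI_pos : volume I ≠ 0) (hI_fin : volume I ≠ ∞) :
    ¬ FiniteDimensional ℂ (LinearMap.range (projP I hI).toLinearMap) := by
  intro hfd
  obtain ⟨b, hb⟩ := exists_ne_zero_Rn hn
  obtain ⟨t, htI, ht, hteq⟩ := hI.exists_measurable_subset_ae_eq
  have htv : volume t = volume I := measure_congr hteq
  let f : L2Rn n := indicatorConstLp 2 ht (by rwa [htv]) (1 : ℂ)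
  have hf0 : f ≠ 0 := by
    intro h
    have h1 : ‖f‖ = 0 := by rw [h, norm_zero]
    rw [norm_indicatorConstLp (by norm_num) (by norm_num), norm_one, one_mul] at h1
    rw [Real.rpow_eq_zero measureReal_nonneg (by norm_num), measureReal_eq_zero_iff
      (by rwa [htv]), htv] at h1
    exact hI_pos h1
  have hf : projP I hI f = f := by
    refine Lp.ext ?_
    filter_upwards [coeFn_projP I hI f, indicatorConstLp_coeFn (p := 2) (hs := ht)
      (hμs := (by rwa [htv] : volume t ≠ ∞)) (c := (1 : ℂ))] with x h1 h2
    rw [h1]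
    by_cases h : x ∈ I
    · simp [h]
    · rw [Set.indicator_of_notMem h]
      exact (h2.trans (Set.indicator_of_notMem (fun h3 => h (htI h3)) _)).symm
  have hli := linearIndependent_modulate hb hf0
  let v : ℕ → LinearMap.range (projP I hI).toLinearMap := fun k =>
    ⟨modulate (k • b) f, modulate (k • b) f, projP_modulate hf _⟩
  have hv : LinearIndependent ℂ v :=
    LinearIndependent.of_comp (LinearMap.range (projP I hI).toLinearMap).subtype hli
  exact not_finite_iff_infinite.mpr inferInstance hv.finite

/-- A finite-dimensional space of vectors fixed by `T` has dimension at most `‖T‖²_HS`. -/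
theorem finrank_le_hsNorm_sq {H : Type*} [NormedAddCommGroup H] [InnerProductSpace ℂ H]
    [CompleteSpace H] (T : H →L[ℂ] H) (V : Submodule ℂ H) [FiniteDimensional ℂ V]
    (hV : ∀ v ∈ V, T v = v) : (Module.finrank ℂ V : ℝ≥0∞) ≤ hsNorm T ^ 2 := by
  refine le_trans (le_of_eq ?_)
    (tsum_enorm_sq_comp_isometry_le (stdOrthonormalBasis ℂ V).toHilbertBasis V.subtypeₗᵢ T)
  have h1 : ∀ i, ‖T (V.subtypeₗᵢ ((stdOrthonormalBasis ℂ V).toHilbertBasis i))‖ₑ ^ 2 = 1 := by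
    intro i
    have h2 : T (V.subtypeₗᵢ ((stdOrthonormalBasis ℂ V).toHilbertBasis i)) =
        V.subtypeₗᵢ ((stdOrthonormalBasis ℂ V).toHilbertBasis i) := hV _ (Subtype.property _)
    rw [h2, ← ofReal_norm, LinearIsometry.norm_map, HilbertBasis.orthonormal _ |>.1 i]
    simp
  simp_rw [h1]
  simp

/-- A set of finite positive measure and finitely many of its small translates lie in a set of at
most twice its measure. -/
theorem exists_translates_subset (hn : 0 < n) {J : Set (Rn n)} (hJ : NullMeasurableSet J volume)
    (hJ_pos : volume J ≠ 0) (hJ_fin : volume J ≠ ∞) (N : ℕ) :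
    ∃ (b : Rn n) (K : Set (Rn n)), b ≠ 0 ∧ MeasurableSet K ∧ volume K ≤ 2 * volume J ∧
      ∀ k < N, ∀ᵐ ξ, ξ ∈ J → ξ + k • b ∈ K := by
  obtain ⟨t, htJ, ht, hteq⟩ := hJ.exists_measurable_subset_ae_eq
  have htv : volume t = volume J := measure_congr hteq
  -- One `ε` for enlarging the compact set `C` to `U` and `N` more for the translates of the
  -- remainder `t \ C`: altogether `(N + 1)ε = |J|`.
  set ε : ℝ≥0∞ := volume J / (N + 1) with hε
  have hε0 : ε ≠ 0 := (ENNReal.div_pos hJ_pos (by finiteness)).ne'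
  obtain ⟨C, hCt, hC, hCε⟩ := ht.exists_isCompact_sdiff_lt (by rwa [htv]) hε0
  have hC_fin : volume C ≠ ∞ := hC.measure_lt_top.ne
  obtain ⟨U, hCU, hU, hUε⟩ := Set.exists_isOpen_lt_add C hC_fin hε0
  obtain ⟨δ, hδ, hδU⟩ := hC.exists_thickening_subset_open hU hCU
  obtain ⟨b₀, hb₀⟩ := exists_ne_zero_Rn hn
  -- All shifts `k • (r • b₀)` with `k < N` are shorter than `δ`, so they keep `C` inside `U`.
  set r : ℝ := δ / ((N + 1) * ‖b₀‖) with hr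
  have hb₀' : 0 < ‖b₀‖ := norm_pos_iff.mpr hb₀
  have hr0 : 0 < r := by positivity
  refine ⟨r • b₀, U ∪ ⋃ k ∈ Finset.range N, (fun x => x - k • (r • b₀)) ⁻¹' (t \ C),
    smul_ne_zero hr0.ne' hb₀, hU.measurableSet.union
    (Finset.measurableSet_biUnion _ fun k _ => (measurable_sub_const _) (ht.diff hC.measurableSet)),
    ?_, ?_⟩
  · calc volume (U ∪ ⋃ k ∈ Finset.range N, (fun x => x - k • (r • b₀)) ⁻¹' (t \ C))
        ≤ volume U + ∑ k ∈ Finset.range N, volume ((fun x => x - k • (r • b₀)) ⁻¹' (t \ C)) :=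
          (measure_union_le _ _).trans (by gcongr; exact measure_biUnion_finset_le _ _)
      _ ≤ (volume J + ε) + ∑ k ∈ Finset.range N, ε := by
          gcongr with k _
          · exact hUε.le.trans (by gcongr; exact hCt.trans htJ)
          · rw [(measurePreserving_sub_right volume _).measure_preimage
              (ht.diff hC.measurableSet).nullMeasurableSet]
            exact hCε.le
      _ = volume J + (N + 1) * ε := by
          rw [Finset.sum_const, Finset.card_range, nsmul_eq_mul]; ring
      _ = 2 * volume J := by
          rw [hε, ENNReal.mul_div_cancel (by positivity) (by finiteness), two_mul]
  · intro k hk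
    filter_upwards [hteq.mem_iff] with ξ hξ hξJ
    have hξt := hξ.mpr hξJ
    by_cases hξC : ξ ∈ C
    · left
      refine hδU (Metric.mem_thickening_iff.mpr ⟨ξ, hξC, ?_⟩)
      rw [dist_eq_norm, add_sub_cancel_left, ← Nat.cast_smul_eq_nsmul ℝ, norm_smul, norm_smul,
        Real.norm_natCast, Real.norm_of_nonneg hr0.le]
      have h1 : r * ‖b₀‖ = δ / (N + 1) := by
        rw [hr]; field_simp
      rw [h1, mul_div_assoc', div_lt_iff₀ (by positivity), mul_comm]
      have : (k : ℝ) < N := by exact_mod_cast hk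
      gcongr
      linarith
    · right
      simp only [Set.mem_iUnion]
      exact ⟨k, Finset.mem_range.mpr hk, by simpa using ⟨hξt, hξC⟩⟩

/-- A nonzero function and its Fourier transform cannot both vanish outside sets of finite
measure (Amrein-Berthier, Benedicks). -/
theorem eq_zero_of_projP_eq_of_projQ_eq (hn : 0 < n) {I J : Set (Rn n)}
    (hI : NullMeasurableSet I volume) (hJ : NullMeasurableSet J volume)
    (hI_fin : volume I ≠ ∞) (hJ_pos : volume J ≠ 0) (hJ_fin : volume J ≠ ∞) {f : L2Rn n}
    (hf : projP I hI f = f) (hf2 : projQ J hJ f = f) : f = 0 := by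
  by_contra hf0
  have hfin : volume I * (2 * volume J) ≠ ∞ := by finiteness
  -- `N` independent modulations of `f` are fixed by `Q_K P_I`, whose squared Hilbert-Schmidt norm
  -- is at most `|I| · 2|J| < N`.
  obtain ⟨N, hN⟩ := ENNReal.exists_nat_gt hfin
  obtain ⟨b, K, hb, hK, hKv, hKJ⟩ := exists_translates_subset hn hJ hJ_pos hJ_fin N
  have hli : LinearIndependent ℂ fun k : Fin N => modulate ((k : ℕ) • b) f :=
    (linearIndependent_modulate hb hf0).comp _ Fin.val_injective
  have hrank := finrank_span_eq_card hli
  let V := Submodule.span ℂ (Set.range fun k : Fin N => modulate ((k : ℕ) • b) f)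
  have : FiniteDimensional ℂ V := FiniteDimensional.span_of_finite ℂ (Set.finite_range _)
  have hfix : ∀ v ∈ V, (projQ K hK.nullMeasurableSet * projP I hI) v = v := by
    intro v hv
    induction hv using Submodule.span_induction with
    | mem x hx =>
      obtain ⟨k, rfl⟩ := hx
      change projQ K hK.nullMeasurableSet (projP I hI (modulate ((k : ℕ) • b) f)) = _
      rw [projP_modulate hf]
      exact projQ_modulate hI_fin hf hf2 _ (hKJ k k.2)
    | zero => simp
    | add x y _ _ hx hy => rw [map_add, hx, hy]
    | smul c x _ hx => rw [map_smul, hx]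
  have h1 := finrank_le_hsNorm_sq (projQ K hK.nullMeasurableSet * projP I hI) V hfix
  rw [hsNorm_projQ_mul_projP_sq I K hI _ hI_fin, hrank, Fintype.card_fin] at h1
  have h2 : (N : ℝ≥0∞) ≤ volume I * (2 * volume J) := h1.trans (by gcongr)
  exact absurd hN (not_lt.mpr h2)

end Modulation

/-! ### The generic part and Halmos' theorem -/

section GenericPart

variable {H : Type*} [NormedAddCommGroup H] [InnerProductSpace ℂ H] [CompleteSpace H]
variable {P Q : H →L[ℂ] H}

theorem mem_range_iff_of_mul_self (hP : P * P = P) {x : H} :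
    x ∈ LinearMap.range P.toLinearMap ↔ P x = x := by
  constructor
  · rintro ⟨y, rfl⟩
    exact congrArg (· y) hP
  · exact fun h => ⟨x, h⟩

theorem mem_genericPart_iff (hP : P * P = P) (hQ : Q * Q = Q) {x : H} :
    x ∈ genericPart P Q ↔ (∀ y, P y = y → Q y = y → inner ℂ y x = 0) ∧
      (∀ y, P y = 0 → Q y = 0 → inner ℂ y x = 0) ∧
      (∀ y, P y = y → Q y = 0 → inner ℂ y x = 0) ∧
      (∀ y, P y = 0 → Q y = y → inner ℂ y x = 0) := by
  simp only [genericPart, ← Submodule.inf_orthogonal, Submodule.mem_inf, Submodule.mem_orthogonal,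
    mem_range_iff_of_mul_self hP, mem_range_iff_of_mul_self hQ, LinearMap.mem_ker, and_imp,
    ContinuousLinearMap.coe_coe, and_assoc]

theorem apply_left_mem_genericPart (hP : P * P = P) (hQ : Q * Q = Q) (hPs : IsSelfAdjoint P)
    {x : H} (hx : x ∈ genericPart P Q) : P x ∈ genericPart P Q := by
  rw [mem_genericPart_iff hP hQ] at hx ⊢
  have hsym : ∀ a b, inner ℂ (P a) b = inner ℂ a (P b) := hPs.isSymmetric
  refine ⟨fun y h1 h2 => ?_, fun y h1 h2 => ?_, fun y h1 h2 => ?_, fun y h1 h2 => ?_⟩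
  · rw [← hsym, h1, hx.1 y h1 h2]
  · rw [← hsym, h1, inner_zero_left]
  · rw [← hsym, h1, hx.2.2.1 y h1 h2]
  · rw [← hsym, h1, inner_zero_left]

theorem apply_right_mem_genericPart (hP : P * P = P) (hQ : Q * Q = Q) (hQs : IsSelfAdjoint Q)
    {x : H} (hx : x ∈ genericPart P Q) : Q x ∈ genericPart P Q := by
  rw [mem_genericPart_iff hP hQ] at hx ⊢
  have hsym : ∀ a b, inner ℂ (Q a) b = inner ℂ a (Q b) := hQs.isSymmetric
  refine ⟨fun y h1 h2 => ?_, fun y h1 h2 => ?_, fun y h1 h2 => ?_, fun y h1 h2 => ?_⟩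
  · rw [← hsym, h2, hx.1 y h1 h2]
  · rw [← hsym, h2, inner_zero_left]
  · rw [← hsym, h2, inner_zero_left]
  · rw [← hsym, h2, hx.2.2.2 y h1 h2]

theorem isClosed_genericPart (P Q : H →L[ℂ] H) : IsClosed (genericPart P Q : Set H) :=
  Submodule.isClosed_orthogonal _

instance completeSpace_genericPart (P Q : H →L[ℂ] H) : CompleteSpace (genericPart P Q) :=
  (isClosed_genericPart P Q).completeSpace_coe

end GenericPart

section Angle

variable {K : Type*} [NormedAddCommGroup K] [InnerProductSpace ℂ K] [CompleteSpace K]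

theorem opCos_opSin_commute (X : K →L[ℂ] K) : opCos X * opSin X = opSin X * opCos X :=
  (cfc_commute_cfc Real.cos Real.sin X).eq

theorem isSelfAdjoint_opCos (X : K →L[ℂ] K) : IsSelfAdjoint (opCos X) := cfc_predicate _ _

theorem isSelfAdjoint_opSin (X : K →L[ℂ] K) : IsSelfAdjoint (opSin X) := cfc_predicate _ _

theorem opSin_mul_self_add_opCos_mul_self {X : K →L[ℂ] K} (hX : IsSelfAdjoint X) :
    opSin X * opSin X + opCos X * opCos X = 1 := by
  rw [opSin, opCos, ← pow_two, ← pow_two, ← cfc_pow Real.sin 2 X, ← cfc_pow Real.cos 2 X,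
    ← cfc_add (a := X) _ _]
  simp only [Real.sin_sq_add_cos_sq]
  exact cfc_const_one ℝ X

/-- The angle operator `X = arccos √A` of a contraction `0 ≤ A ≤ 1`. -/
theorem exists_angle {A : K →L[ℂ] K} (hA : 0 ≤ A) (hA1 : A ≤ 1)
    (hfix : ∀ a, A a = a → a = 0) :
    ∃ X : K →L[ℂ] K, 0 ≤ X ∧ X ≤ (Real.pi / 2 : ℝ) • (1 : K →L[ℂ] K) ∧
      LinearMap.ker X.toLinearMap = ⊥ ∧ opCos X * opCos X = A ∧ opSin X * opSin X = 1 - A := by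
  have hAs : IsSelfAdjoint A := .of_nonneg hA
  have hspec : ∀ t ∈ spectrum ℝ A, 0 ≤ t ∧ t ≤ 1 := by
    intro t ht
    refine ⟨spectrum_nonneg_of_nonneg hA ht, ?_⟩
    have h1 : cfc (id : ℝ → ℝ) A ≤ 1 := by rwa [cfc_id ℝ A]
    exact (cfc_le_one_iff id A).mp h1 t ht
  have hcont : ContinuousOn (fun t => Real.arccos √t) (spectrum ℝ A) :=
    (Real.continuous_arccos.comp Real.continuous_sqrt).continuousOn
  have hcos : opCos (cfc (fun t => Real.arccos √t) A) = cfc Real.sqrt A := by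
    rw [opCos, ← cfc_comp' Real.cos _ A Real.continuous_cos.continuousOn hcont]
    refine cfc_congr fun t ht => ?_
    exact Real.cos_arccos (by linarith [Real.sqrt_nonneg t])
      (Real.sqrt_le_one.mpr (hspec t ht).2)
  have hcos2 : opCos (cfc (fun t => Real.arccos √t) A) * opCos (cfc (fun t => Real.arccos √t) A)
      = A := by
    rw [hcos, ← cfc_mul Real.sqrt Real.sqrt A Real.continuous_sqrt.continuousOn
      Real.continuous_sqrt.continuousOn]
    conv_rhs => rw [← cfc_id ℝ A]
    exact cfc_congr fun t ht => Real.mul_self_sqrt (hspec t ht).1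
  have hXs : IsSelfAdjoint (cfc (fun t => Real.arccos √t) A) := cfc_predicate _ _
  refine ⟨cfc (fun t => Real.arccos √t) A, cfc_nonneg fun t _ => Real.arccos_nonneg _, ?_, ?_,
    hcos2, ?_⟩
  · rw [← Algebra.algebraMap_eq_smul_one]
    exact cfc_le_algebraMap _ _ A (fun t _ => Real.arccos_le_pi_div_two.mpr (Real.sqrt_nonneg t))
      hcont
  -- A null vector of `X` is a `1`-eigenvector of `cos X`, hence is fixed by `A`.
  · rw [Submodule.eq_bot_iff]
    intro a ha
    have h0 : cfc (fun t => Real.arccos √t) A a = ((0 : ℝ) : ℂ) • a := by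
      rw [Complex.ofReal_zero, zero_smul]; exact ha
    have h1 := cfc_apply_eigenvector hXs h0 Real.continuous_cos
    rw [Real.cos_zero, Complex.ofReal_one, one_smul] at h1
    refine hfix a ?_
    rw [← hcos2]
    change opCos _ (opCos _ a) = a
    rw [opCos, h1, h1]
  · have h := opSin_mul_self_add_opCos_mul_self hXs
    rw [hcos2] at h
    exact eq_sub_of_add_eq h

/-- The isometric factor of an operator `D` with `D*D = T²` for an injective selfadjoint `T`. -/
theorem exists_isometry_comp_eq {H : Type*} [NormedAddCommGroup H] [InnerProductSpace ℂ H]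
    [CompleteSpace H] {T : K →L[ℂ] K} (hT : IsSelfAdjoint T) (hinj : ∀ a, T a = 0 → a = 0)
    (D : K →L[ℂ] H) (hD : ∀ a, ‖D a‖ = ‖T a‖) :
    DenseRange T ∧ ∃ W : K →ₗᵢ[ℂ] H, ∀ a, W (T a) = D a := by
  have hdense : DenseRange T := by
    -- The complement of the range of a selfadjoint operator is its kernel.
    have h1 : (LinearMap.range T.toLinearMap)ᗮ = ⊥ := by
      rw [Submodule.eq_bot_iff]
      intro x hx
      refine hinj x ?_
      rw [Submodule.mem_orthogonal] at hx
      rw [← inner_self_eq_zero (𝕜 := ℂ)]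
      have h2 : inner ℂ (T (T x)) x = inner ℂ (T x) (T x) := hT.isSymmetric (T x) x
      rw [← h2]
      exact hx _ ⟨T x, rfl⟩
    have h2 : (LinearMap.range T.toLinearMap).topologicalClosure = ⊤ := by
      rw [← Submodule.orthogonal_orthogonal_eq_closure, h1, Submodule.bot_orthogonal_eq_top]
    have h3 := Submodule.dense_iff_topologicalClosure_eq_top.mpr h2
    rwa [LinearMap.coe_range] at h3
  have hb : ∀ a, ‖(D : K →ₗ[ℂ] H) a‖ ≤ 1 * ‖(T : K →ₗ[ℂ] K) a‖ := by
    intro a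
    rw [one_mul]; exact (hD a).le
  have hdense' : DenseRange (T : K →ₗ[ℂ] K) := hdense
  let W := (D : K →ₗ[ℂ] H).extendOfNorm (T : K →ₗ[ℂ] K)
  have hW : ∀ a, W (T a) = D a := LinearMap.extendOfNorm_eq hdense' ⟨1, hb⟩
  refine ⟨hdense, ⟨(W : K →ₗ[ℂ] H), fun x => ?_⟩, hW⟩
  refine hdense.induction_on (p := fun x => ‖W x‖ = ‖x‖) x
    (isClosed_eq W.continuous.norm continuous_norm) fun a => ?_
  rw [hW, hD]

end Angle

section Halmos

variable {H : Type*} [NormedAddCommGroup H] [InnerProductSpace ℂ H] [CompleteSpace H]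

/-- The part of the range of `P` in the generic part of `(P, Q)`. -/
def genericRange (P Q : H →L[ℂ] H) : Submodule ℂ H :=
  LinearMap.ker (1 - P).toLinearMap ⊓ genericPart P Q

variable {P Q : H →L[ℂ] H}

theorem mem_genericRange_iff {x : H} :
    x ∈ genericRange P Q ↔ P x = x ∧ x ∈ genericPart P Q := by
  rw [genericRange, Submodule.mem_inf, LinearMap.mem_ker]
  refine and_congr_left fun _ => ?_
  change x - P x = 0 ↔ _
  rw [sub_eq_zero, eq_comm]

instance completeSpace_genericRange (P Q : H →L[ℂ] H) : CompleteSpace (genericRange P Q) :=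
  ((1 - P).isClosed_ker.inter (isClosed_genericPart P Q)).completeSpace_coe

/-- Halmos' theorem on the generic part of a pair of projections. -/
theorem exists_isHalmosDecomposition (hP : P * P = P) (hQ : Q * Q = Q) (hPs : IsSelfAdjoint P)
    (hQs : IsSelfAdjoint Q) :
    ∃ (V : genericPart P Q ≃ₗᵢ[ℂ] WithLp 2 (genericRange P Q × genericRange P Q))
      (X : genericRange P Q →L[ℂ] genericRange P Q), IsHalmosDecomposition P Q V X := by
  have hPsym : ∀ a b, inner ℂ (P a) b = inner ℂ a (P b) := hPs.isSymmetric
  have hQsym : ∀ a b, inner ℂ (Q a) b = inner ℂ a (Q b) := hQs.isSymmetric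
  have hPP : ∀ x, P (P x) = P x := fun x => congrArg (· x) hP
  have hQQ : ∀ x, Q (Q x) = Q x := fun x => congrArg (· x) hQ
  have hfix : ∀ a : genericRange P Q, P a = a := fun a => (mem_genericRange_iff.mp a.2).1
  have hgen : ∀ a : genericRange P Q, (a : H) ∈ genericPart P Q :=
    fun a => (mem_genericRange_iff.mp a.2).2
  have hg0 : ∀ x ∈ genericPart P Q, (P x = x ∨ P x = 0) → (Q x = x ∨ Q x = 0) → x = 0 := by
    intro x hx h1 h2
    have h3 := (mem_genericPart_iff hP hQ).mp hx
    rw [← inner_self_eq_zero (𝕜 := ℂ)]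
    rcases h1 with h1 | h1 <;> rcases h2 with h2 | h2
    · exact h3.1 x h1 h2
    · exact h3.2.2.1 x h1 h2
    · exact h3.2.2.2 x h1 h2
    · exact h3.2.1 x h1 h2
  -- The compression of `Q` to the range of `P`; it will be `cos²X`.
  let A : genericRange P Q →L[ℂ] genericRange P Q :=
    (P ∘L Q ∘L (genericRange P Q).subtypeL).codRestrict _ fun a =>
      mem_genericRange_iff.mpr ⟨hPP _, apply_left_mem_genericPart hP hQ hPs
        (apply_right_mem_genericPart hP hQ hQs (hgen a))⟩
  have hA : ∀ a, (A a : H) = P (Q a) := fun a => rfl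
  have hAin : ∀ a b : genericRange P Q, inner ℂ (A a) b = inner ℂ (Q (a : H)) (Q (b : H)) := by
    intro a b
    change inner ℂ (P (Q (a : H))) (b : H) = _
    rw [hPsym, hfix, ← hQQ a, hQsym, hQQ]
  have hAs : IsSelfAdjoint A := by
    rw [ContinuousLinearMap.isSelfAdjoint_iff_isSymmetric]
    intro a b
    change inner ℂ (A a) b = inner ℂ a (A b)
    rw [hAin, ← inner_conj_symm a, hAin, inner_conj_symm]
  have hQle : ∀ x : H, ‖Q x‖ ^ 2 ≤ ‖x‖ ^ 2 := by
    intro x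
    have h1 : ‖Q x‖ ^ 2 + ‖x - Q x‖ ^ 2 = ‖x‖ ^ 2 := by
      have h2 : inner ℂ (Q x) (x - Q x) = 0 := by
        rw [hQsym, map_sub, hQQ, sub_self, inner_zero_right]
      have h3 := norm_add_sq_eq_norm_sq_add_norm_sq_of_inner_eq_zero (Q x) (x - Q x) h2
      rw [add_sub_cancel] at h3
      nlinarith
    nlinarith [sq_nonneg ‖x - Q x‖]
  have hA0 : 0 ≤ A := by
    rw [ContinuousLinearMap.nonneg_iff_isPositive, ContinuousLinearMap.isPositive_def']
    refine ⟨hAs, fun a => ?_⟩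
    rw [ContinuousLinearMap.reApplyInnerSelf_apply, hAin, inner_self_eq_norm_sq]
    positivity
  have hA1 : A ≤ 1 := by
    rw [← sub_nonneg, ContinuousLinearMap.nonneg_iff_isPositive,
      ContinuousLinearMap.isPositive_def']
    refine ⟨(IsSelfAdjoint.one _).sub hAs, fun a => ?_⟩
    rw [ContinuousLinearMap.reApplyInnerSelf_apply, sub_apply, inner_sub_left, hAin, map_sub,
      inner_self_eq_norm_sq]
    change 0 ≤ RCLike.re (inner ℂ a a) - _
    rw [inner_self_eq_norm_sq, sub_nonneg]
    exact hQle a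
  have hQfix : ∀ x : H, ‖Q x‖ = ‖x‖ → Q x = x := by
    intro x hx
    have h2 : inner ℂ (Q x) (x - Q x) = 0 := by
      rw [hQsym, map_sub, hQQ, sub_self, inner_zero_right]
    have h3 := norm_add_sq_eq_norm_sq_add_norm_sq_of_inner_eq_zero (Q x) (x - Q x) h2
    rw [add_sub_cancel, hx] at h3
    have h4 : ‖x - Q x‖ = 0 := by nlinarith [norm_nonneg (x - Q x)]
    exact (sub_eq_zero.mp (norm_eq_zero.mp h4)).symm
  have hAfix : ∀ a, A a = a → a = 0 := by
    intro a ha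
    have h1 := hAin a a
    rw [ha, inner_self_eq_norm_sq_to_K, inner_self_eq_norm_sq_to_K] at h1
    have h2 : ‖a‖ ^ 2 = ‖Q (a : H)‖ ^ 2 := by exact_mod_cast h1
    have h3 : ‖Q (a : H)‖ = ‖(a : H)‖ :=
      (sq_eq_sq₀ (norm_nonneg _) (norm_nonneg _)).mp h2.symm
    exact Subtype.ext (hg0 a (hgen a) (Or.inl (hfix a)) (Or.inl (hQfix _ h3)))
  obtain ⟨X, hX0, hX1, hXk, hC2, hS2⟩ := exists_angle hA0 hA1 hAfix
  have hcomm := opCos_opSin_commute X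
  have hT : IsSelfAdjoint (opCos X * opSin X) :=
    ((isSelfAdjoint_opCos X).commute_iff (isSelfAdjoint_opSin X)).mp hcomm
  have hT2 : opCos X * opSin X * (opCos X * opSin X) = A - A * A := by
    rw [mul_assoc, ← mul_assoc (opSin X), ← hcomm, mul_assoc (opCos X) (opSin X), hS2, ← mul_assoc,
      hC2, mul_sub, mul_one]
  -- The corner `(1 - P)Q`. As `D*D = A - A² = (CS)²`, it factors as `W CS` with `W` an isometry,
  -- which identifies a second copy of `L` inside `N(P)`.
  let D : genericRange P Q →L[ℂ] H := (Q - P * Q) ∘L (genericRange P Q).subtypeL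
  have hD : ∀ a, D a = Q a - A a := fun a => rfl
  have hDT : ∀ a, ‖D a‖ = ‖(opCos X * opSin X) a‖ := by
    intro a
    have h1 : ‖(opCos X * opSin X) a‖ ^ 2 = ‖Q (a : H)‖ ^ 2 - ‖A a‖ ^ 2 := by
      have h2 : inner ℂ ((opCos X * opSin X) ((opCos X * opSin X) a)) a =
        inner ℂ ((opCos X * opSin X) a) ((opCos X * opSin X) a) := hT.isSymmetric _ _
      have h3 : (opCos X * opSin X) ((opCos X * opSin X) a) = A a - A (A a) :=
        congrArg (· a) hT2
      have h4 : inner ℂ (A (A a)) a = inner ℂ (A a) (A a) := hAs.isSymmetric _ _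
      rw [h3, inner_sub_left, h4, hAin, inner_self_eq_norm_sq_to_K, inner_self_eq_norm_sq_to_K,
        inner_self_eq_norm_sq_to_K] at h2
      exact_mod_cast h2.symm
    have h5 : ‖D a‖ ^ 2 = ‖Q (a : H)‖ ^ 2 - ‖A a‖ ^ 2 := by
      have h6 : inner ℂ (A a : H) (D a) = 0 := by
        rw [← hfix (A a), hPsym, hD, map_sub, hfix, hA, sub_self, inner_zero_right]
      have h7 := norm_add_sq_eq_norm_sq_add_norm_sq_of_inner_eq_zero (A a : H) (D a) h6
      rw [hD, add_sub_cancel] at h7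
      have h8 : ‖(A a : H)‖ = ‖A a‖ := rfl
      rw [h8] at h7
      rw [hD]
      nlinarith
    rw [← sq_eq_sq₀ (norm_nonneg _) (norm_nonneg _), h1, h5]
  -- `D a = 0` puts `Qa = Aa` in both ranges, so `Qa = 0`, and then `a` is in `R(P) ∩ N(Q)`; both
  -- intersections are trivial in the generic part.
  have hTinj : ∀ a, (opCos X * opSin X) a = 0 → a = 0 := by
    intro a ha
    have h1 : D a = 0 := by rw [← norm_eq_zero, hDT, ha, norm_zero]
    rw [hD, sub_eq_zero] at h1
    have h2 : Q (a : H) = 0 := hg0 _ (apply_right_mem_genericPart hP hQ hQs (hgen a))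
      (Or.inl (by rw [h1, hfix])) (Or.inl (hQQ _))
    exact Subtype.ext (hg0 a (hgen a) (Or.inl (hfix a)) (Or.inr h2))
  obtain ⟨hdense, W, hW⟩ := exists_isometry_comp_eq hT hTinj D hDT
  have hPW : ∀ b, P (W b) = 0 := fun b =>
    hdense.induction_on (p := fun b => P (W b) = 0) b
      (isClosed_eq (P.continuous.comp W.continuous) continuous_const) fun a => by
        rw [hW, hD, map_sub, hfix, hA, sub_self]
  have hWgen : ∀ b, W b ∈ genericPart P Q := fun b =>
    hdense.induction_on (p := fun b => W b ∈ genericPart P Q) b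
      ((isClosed_genericPart P Q).preimage W.continuous) fun a => by
        rw [hW, hD]
        exact sub_mem (apply_right_mem_genericPart hP hQ hQs (hgen a)) (hgen _)
  have hQa : ∀ a : genericRange P Q, Q a = (opCos X (opCos X a) : H) + W (opCos X (opSin X a)) := by
    intro a
    have h1 : opCos X (opCos X a) = A a := congrArg (· a) hC2
    have h2 : W (opCos X (opSin X a)) = D a := hW a
    rw [h1, h2, hD, add_sub_cancel]
  have hQW : ∀ b : genericRange P Q,
      Q (W b) = (opCos X (opSin X b) : H) + W (opSin X (opSin X b)) := fun b =>
    -- By density it suffices to take `b = CS a`, where `W b = D a = Qa - Aa` is explicit.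
    hdense.induction_on
      (p := fun b => Q (W b) = (opCos X (opSin X b) : H) + W (opSin X (opSin X b))) b
      (isClosed_eq (Q.continuous.comp W.continuous)
        ((continuous_subtype_val.comp ((opCos X).continuous.comp (opSin X).continuous)).add
          (W.continuous.comp ((opSin X).continuous.comp (opSin X).continuous)))) fun a => by
        have h1 : opCos X (opSin X ((opCos X * opSin X) a)) = A a - A (A a) :=
          congrArg (· a) hT2
        have h2 : opSin X (opSin X ((opCos X * opSin X) a)) = (opCos X * opSin X) (a - A a) := by
          have h3 : opSin X * opSin X * (opCos X * opSin X) = (opCos X * opSin X) * (1 - A) := by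
            have hc : Commute (opCos X * opSin X) (opSin X) :=
              Commute.mul_left hcomm (Commute.refl _)
            rw [← hS2]
            exact (hc.mul_right hc).eq.symm
          exact congrArg (· a) h3
        rw [h1, h2, hW, hW, hD, hD, map_sub, hQQ, map_sub A]
        push_cast
        rw [map_sub]
        abel
  have hortho : ∀ a b : genericRange P Q, inner ℂ (a : H) (W b) = 0 := by
    intro a b
    rw [← hfix a, hPsym, hPW, inner_zero_right]
  let Φ : WithLp 2 (genericRange P Q × genericRange P Q) →ₗᵢ[ℂ] genericPart P Q :=
    { toFun := fun x => ⟨(x.fst : H) + W x.snd, add_mem (hgen _) (hWgen _)⟩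
      map_add' := fun x y => Subtype.ext (by simp [add_add_add_comm])
      map_smul' := fun c x => Subtype.ext (by simp)
      norm_map' := fun x => by
        rw [← sq_eq_sq₀ (norm_nonneg _) (norm_nonneg _), WithLp.prod_norm_sq_eq_of_L2]
        change ‖(x.fst : H) + W x.snd‖ ^ 2 = _
        have h := norm_add_sq_eq_norm_sq_add_norm_sq_of_inner_eq_zero (x.fst : H) (W x.snd)
          (hortho _ _)
        rw [W.norm_map, ← Submodule.coe_norm] at h
        nlinarith }
  have hΦ : ∀ a b, (Φ (WithLp.toLp 2 (a, b)) : H) = (a : H) + W b := fun _ _ => rfl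
  have hsurj : Function.Surjective Φ := by
    have hc : CompleteSpace (LinearMap.range Φ.toLinearMap) :=
      (Φ.isometry.isUniformInducing.isComplete_range).completeSpace_coe
    rw [← LinearIsometry.coe_toLinearMap, ← LinearMap.range_eq_top,
      ← Submodule.orthogonal_eq_bot_iff, Submodule.eq_bot_iff]
    intro y hy
    rw [Submodule.mem_orthogonal] at hy
    have hy' : ∀ a b : genericRange P Q, inner ℂ ((a : H) + W b) (y : H) = 0 := fun a b =>
      hy _ ⟨WithLp.toLp 2 (a, b), rfl⟩
    have h1 : ∀ a : genericRange P Q, inner ℂ (a : H) (y : H) = 0 := fun a => by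
      simpa using hy' a 0
    have hPy : P (y : H) = 0 := by
      have h2 := h1 ⟨P y, mem_genericRange_iff.mpr
        ⟨hPP _, apply_left_mem_genericPart hP hQ hPs y.2⟩⟩
      rw [← inner_self_eq_zero (𝕜 := ℂ), ← hPsym, hPP]
      exact h2
    have h3 : ∀ a : genericRange P Q, inner ℂ (Q (a : H)) (y : H) = 0 := fun a => by
      rw [hQa]; exact hy' _ _
    have hPQy : P (Q (y : H)) = 0 := by
      have h4 := h3 ⟨P (Q y), mem_genericRange_iff.mpr
        ⟨hPP _, apply_left_mem_genericPart hP hQ hPs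
          (apply_right_mem_genericPart hP hQ hQs y.2)⟩⟩
      rw [hQsym] at h4
      rw [← inner_self_eq_zero (𝕜 := ℂ), ← hPsym, hPP]
      exact h4
    -- A `y` orthogonal to the image has `Py = 0` and `PQy = 0`; then `Qy` is in `N(P) ∩ R(Q)`, so
    -- `Qy = 0`, and `y` itself is in `N(P) ∩ N(Q)`.
    have hQy : Q (y : H) = 0 := hg0 _ (apply_right_mem_genericPart hP hQ hQs y.2)
      (Or.inr hPQy) (Or.inl (hQQ _))
    exact Subtype.ext (hg0 _ y.2 (Or.inr hPy) (Or.inr hQy))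
  refine ⟨(LinearIsometryEquiv.ofSurjective Φ hsurj).symm, X, hX0, hX1, hXk, ?_, ?_⟩
  · intro a b
    simp only [LinearIsometryEquiv.symm_symm, LinearIsometryEquiv.coe_ofSurjective, hΦ]
    rw [map_add, hPW, hfix, map_zero]
  · intro a b
    simp only [LinearIsometryEquiv.symm_symm, LinearIsometryEquiv.coe_ofSurjective, hΦ]
    have hcomm' : opSin X (opCos X a) = opCos X (opSin X a) := (congrArg (· a) hcomm).symm
    rw [map_add, hQa, hQW, map_add]
    push_cast
    abel

end Halmos

section OrthogonalGeneric

variable {H : Type*} [NormedAddCommGroup H] [InnerProductSpace ℂ H] [CompleteSpace H]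
variable {P Q : H →L[ℂ] H}

theorem apply_eq_zero_of_mem_orthogonal_genericPart (hP : P * P = P) (hQ : Q * Q = Q)
    {T : H →L[ℂ] H} (h1 : ∀ y, P y = y → Q y = y → T y = 0) (h2 : ∀ y, P y = 0 → Q y = 0 → T y = 0)
    (h3 : ∀ y, P y = y → Q y = 0 → T y = 0) (h4 : ∀ y, P y = 0 → Q y = y → T y = 0) {y : H}
    (hy : y ∈ (genericPart P Q)ᗮ) : T y = 0 := by
  rw [genericPart, Submodule.orthogonal_orthogonal_eq_closure] at hy
  refine Submodule.topologicalClosure_minimal (t := LinearMap.ker T.toLinearMap) _ ?_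
    T.isClosed_ker hy
  refine sup_le (sup_le (sup_le ?_ ?_) ?_) ?_ <;> rintro y ⟨ha, hb⟩
  · exact h1 y ((mem_range_iff_of_mul_self hP).mp ha) ((mem_range_iff_of_mul_self hQ).mp hb)
  · exact h2 y ha hb
  · exact h3 y ((mem_range_iff_of_mul_self hP).mp ha) hb
  · exact h4 y ha ((mem_range_iff_of_mul_self hQ).mp hb)

/-- Of the four intersections only `R(P) ∩ R(Q)` survives `QP`, and it is assumed trivial;
continuity passes to the closure of their sum. -/
theorem mul_apply_eq_zero_of_mem_orthogonal_genericPart (hP : P * P = P) (hQ : Q * Q = Q)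
    (hPQ : ∀ x, P x = x → Q x = x → x = 0) {y : H} (hy : y ∈ (genericPart P Q)ᗮ) :
    (Q * P) y = 0 := by
  have e : ∀ z, (Q * P) z = Q (P z) := fun _ => rfl
  refine apply_eq_zero_of_mem_orthogonal_genericPart hP hQ (fun z h1 h2 => ?_)
    (fun z h1 h2 => ?_) (fun z h1 h2 => ?_) (fun z h1 h2 => ?_) hy <;> rw [e, h1]
  · rw [hPQ z h1 h2, map_zero]
  · exact map_zero Q
  · exact h2
  · exact map_zero Q

end OrthogonalGeneric

/-! ### Eigenvectors of the block operator `X⁰` -/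

section Block

variable {L : Type*} [NormedAddCommGroup L] [InnerProductSpace ℂ L] [CompleteSpace L]
variable {X : L →L[ℂ] L}

theorem codiagonalBlock_toLp (X : L →L[ℂ] L) (a c : L) :
    codiagonalBlock X (WithLp.toLp 2 (a, c)) =
      WithLp.toLp 2 (-(Complex.I • X c), Complex.I • X a) := by
  simp [codiagonalBlock]

theorem isSelfAdjoint_codiagonalBlock (hX : IsSelfAdjoint X) :
    IsSelfAdjoint (codiagonalBlock X) := by
  have hsym : ∀ a b, inner ℂ (X a) b = inner ℂ a (X b) := hX.isSymmetric
  rw [ContinuousLinearMap.isSelfAdjoint_iff_isSymmetric]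
  rintro ⟨a, c⟩ ⟨a', c'⟩
  change inner ℂ (codiagonalBlock X (WithLp.toLp 2 (a, c))) (WithLp.toLp 2 (a', c')) =
    inner ℂ (WithLp.toLp 2 (a, c)) (codiagonalBlock X (WithLp.toLp 2 (a', c')))
  rw [codiagonalBlock_toLp, codiagonalBlock_toLp, WithLp.prod_inner_apply,
    WithLp.prod_inner_apply]
  simp only [inner_neg_left, inner_neg_right, inner_smul_left, inner_smul_right, Complex.conj_I,
    hsym]
  ring

/-- Each eigenvalue `γ` of `X` gives the pair `±γ` of the block, with eigenvectors `(a, ±ia)`; `ε`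
is the sign. Testing against both signs recovers both coordinates, so these vectors are total when
those of `X` are. -/
theorem codiagonalBlock_eigenvector {γ : ℝ} {a : L} (ha : X a = (γ : ℂ) • a) {ε : ℝ}
    (hε : ε * ε = 1) :
    codiagonalBlock X (WithLp.toLp 2 (a, ((ε : ℂ) * Complex.I) • a)) =
      ((ε * γ : ℝ) : ℂ) • WithLp.toLp 2 (a, ((ε : ℂ) * Complex.I) • a) := by
  have hε' : (ε : ℂ) * ε = 1 := by exact_mod_cast hε
  rw [codiagonalBlock_toLp, map_smul, ha, ← WithLp.toLp_smul, Prod.smul_mk]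
  congr 2
  · rw [smul_smul, smul_smul, ← neg_smul]
    congr 1
    push_cast
    linear_combination (-(ε : ℂ) * γ) * Complex.I_mul_I
  · rw [smul_smul, smul_smul]
    congr 1
    push_cast
    linear_combination (-(Complex.I * γ)) * hε'

theorem exists_isEigenbasis_codiagonalBlock {L : Type} [NormedAddCommGroup L]
    [InnerProductSpace ℂ L] [CompleteSpace L] {X : L →L[ℂ] L} (hX : IsSelfAdjoint X)
    {ι : Type*} {b : HilbertBasis ι ℂ L} {γ : ι → ℝ} (hb : IsEigenbasis X b γ) :
    ∃ (κ : Type) (c : HilbertBasis κ ℂ (WithLp 2 (L × L))) (μ : κ → ℝ),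
      IsEigenbasis (codiagonalBlock X) c μ := by
  refine exists_isEigenbasis (isSelfAdjoint_codiagonalBlock hX) ?_
  rintro ⟨u, v⟩ hx
  have h1 : ∀ (ε : ℝ), ε * ε = 1 → ∀ i,
      inner ℂ (b i) u + (-((ε : ℂ) * Complex.I)) * inner ℂ (b i) v = 0 := by
    intro ε hε i
    have h2 := hx _ _ (codiagonalBlock_eigenvector (hb i) hε)
    rw [WithLp.prod_inner_apply] at h2
    simpa [inner_smul_left] using h2
  have h2 : ∀ i, inner ℂ (b i) u = 0 ∧ inner ℂ (b i) v = 0 := by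
    intro i
    have h3 := h1 1 (by norm_num) i
    have h4 := h1 (-1) (by norm_num) i
    push_cast at h3 h4
    constructor
    · linear_combination (h3 + h4) / 2
    · linear_combination (Complex.I / 2) * (h3 - h4) +
        inner ℂ (b i) v * Complex.I_mul_I
  rw [b.eq_zero_of_inner fun i => (h2 i).1, b.eq_zero_of_inner fun i => (h2 i).2]
  rfl

theorem apply_eq_abs_smul_of_codiagonalBlock (hX : 0 ≤ X) {a c : L} {μ : ℝ} (hμ : μ ≠ 0)
    (h : codiagonalBlock X (WithLp.toLp 2 (a, c)) = (μ : ℂ) • WithLp.toLp 2 (a, c)) :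
    X a = ((|μ| : ℝ) : ℂ) • a ∧ ‖c‖ = ‖a‖ := by
  have hXs : IsSelfAdjoint X := .of_nonneg hX
  have hsym : ∀ a b, inner ℂ (X a) b = inner ℂ a (X b) := hXs.isSymmetric
  rw [codiagonalBlock_toLp, ← WithLp.toLp_smul] at h
  have h' := Prod.mk.inj (WithLp.toLp_injective 2 h)
  have h1 : -(Complex.I • X c) = (μ : ℂ) • a := h'.1
  have h2 : Complex.I • X a = (μ : ℂ) • c := h'.2
  have hXa : X a = (-(Complex.I * μ)) • c := by
    rw [neg_smul, mul_smul, ← h2, smul_smul, Complex.I_mul_I, neg_one_smul, neg_neg]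
  have hXc : X c = (Complex.I * μ) • a := by
    rw [mul_smul, ← h1, smul_neg, smul_smul, Complex.I_mul_I, neg_one_smul, neg_neg]
  constructor
  -- `X²a = μ²a` factors as `(X + |μ|)(X - |μ|)a = 0`, and `X ≥ 0` rules out the eigenvalue `-|μ|`.
  · set d := X a - ((|μ| : ℝ) : ℂ) • a with hd
    have hXd : X d = (-((|μ| : ℝ) : ℂ)) • d := by
      have h3 : X (X a) = ((|μ| : ℝ) * (|μ| : ℝ) : ℂ) • a := by
        rw [hXa, map_smul, hXc, smul_smul]
        congr 1
        have : ((|μ| : ℝ) : ℂ) * ((|μ| : ℝ) : ℂ) = μ * μ := by exact_mod_cast abs_mul_abs_self μ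
        rw [this]
        linear_combination (-(μ : ℂ) * μ) * Complex.I_mul_I
      rw [hd, map_sub, h3, map_smul]
      module
    have h4 := (ContinuousLinearMap.nonneg_iff_isPositive X).mp hX |>.re_inner_nonneg_left d
    rw [hXd, inner_smul_left, inner_self_eq_norm_sq_to_K] at h4
    have h5 : 0 ≤ -|μ| * ‖d‖ ^ 2 := by
      have h6 : (starRingEnd ℂ) (-((|μ| : ℝ) : ℂ)) * ((‖d‖ : ℝ) : ℂ) ^ 2 =
        ((-|μ| * ‖d‖ ^ 2 : ℝ) : ℂ) := by simp
      have h9 : 0 ≤ (((-|μ| * ‖d‖ ^ 2 : ℝ) : ℂ)).re := h6 ▸ h4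
      rwa [Complex.ofReal_re] at h9
    have h7 : ‖d‖ = 0 := by
      by_contra hne
      have := abs_pos.mpr hμ
      have h8 : 0 < |μ| * ‖d‖ ^ 2 := by positivity
      linarith
    exact sub_eq_zero.mp (norm_eq_zero.mp h7)
  -- `⟨Xa, c⟩ = ⟨a, Xc⟩` reads `iμ‖c‖² = iμ‖a‖²`.
  · have h3 := hsym a c
    rw [hXa, hXc, inner_smul_left, inner_smul_right, inner_self_eq_norm_sq_to_K,
      inner_self_eq_norm_sq_to_K] at h3
    simp only [map_neg, map_mul, Complex.conj_I, Complex.conj_ofReal, neg_mul, neg_neg] at h3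
    have h4 := mul_left_cancel₀
      (mul_ne_zero Complex.I_ne_zero (Complex.ofReal_ne_zero.mpr hμ)) h3
    have h5 : ‖c‖ ^ 2 = ‖a‖ ^ 2 := by exact_mod_cast h4
    exact (sq_eq_sq₀ (norm_nonneg _) (norm_nonneg _)).mp h5

end Block

/-! ### Trace formulas in a Halmos decomposition -/

namespace IsHalmosDecomposition

variable {H : Type*} [NormedAddCommGroup H] [InnerProductSpace ℂ H] [CompleteSpace H]
variable {P Q : H →L[ℂ] H}
variable {L : Type*} [NormedAddCommGroup L] [InnerProductSpace ℂ L] [CompleteSpace L]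
variable {V : genericPart P Q ≃ₗᵢ[ℂ] WithLp 2 (L × L)} {X : L →L[ℂ] L}

theorem isSelfAdjoint (h : IsHalmosDecomposition P Q V X) : IsSelfAdjoint X := .of_nonneg h.nonneg

theorem spectrum_subset (h : IsHalmosDecomposition P Q V X) {t : ℝ} (ht : t ∈ spectrum ℝ X) :
    0 ≤ t ∧ t ≤ Real.pi / 2 := by
  refine ⟨spectrum_nonneg_of_nonneg h.nonneg ht, ?_⟩
  have h1 : cfc (id : ℝ → ℝ) X ≤ algebraMap ℝ (L →L[ℂ] L) (Real.pi / 2) := by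
    rw [cfc_id ℝ X h.isSelfAdjoint, Algebra.algebraMap_eq_smul_one]
    exact h.le_pi_div_two
  exact (cfc_le_algebraMap_iff id _ X continuousOn_id h.isSelfAdjoint).mp h1 t ht

theorem cfc_arccos_cos (h : IsHalmosDecomposition P Q V X) :
    cfc Real.arccos (opCos X) = X := by
  have hX := h.isSelfAdjoint
  rw [opCos, ← cfc_comp' Real.arccos Real.cos X (Real.continuous_arccos.continuousOn)
    (Real.continuous_cos.continuousOn)]
  conv_rhs => rw [← cfc_id ℝ X]
  refine cfc_congr fun t ht => ?_
  exact Real.arccos_cos (h.spectrum_subset ht).1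
    ((h.spectrum_subset ht).2.trans (by linarith [Real.pi_pos]))

/-- The inclusion of the first summand of `L × L` in the generic part. -/
def inclLeft (V : genericPart P Q ≃ₗᵢ[ℂ] WithLp 2 (L × L)) : L →ₗᵢ[ℂ] H where
  toFun a := (V.symm (WithLp.toLp 2 (a, 0)) : H)
  map_add' a b := by
    rw [← Submodule.coe_add, ← map_add, ← WithLp.toLp_add, Prod.mk_add_mk, add_zero]
  map_smul' c a := by
    rw [RingHom.id_apply, ← Submodule.coe_smul, ← map_smul, ← WithLp.toLp_smul, Prod.smul_mk,
      smul_zero]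
  norm_map' a := by
    change ‖V.symm (WithLp.toLp 2 (a, 0))‖ = ‖a‖
    rw [V.symm.norm_map, WithLp.norm_toLp_fst]

theorem inclLeft_apply (V : genericPart P Q ≃ₗᵢ[ℂ] WithLp 2 (L × L)) (a : L) :
    inclLeft V a = (V.symm (WithLp.toLp 2 (a, 0)) : H) := rfl

theorem norm_opCos_sq_add_norm_opSin_sq (h : IsHalmosDecomposition P Q V X) (a : L) :
    ‖opCos X a‖ ^ 2 + ‖opSin X a‖ ^ 2 = ‖a‖ ^ 2 := by
  have h1 : opSin X (opSin X a) + opCos X (opCos X a) = a :=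
    congrArg (· a) (opSin_mul_self_add_opCos_mul_self h.isSelfAdjoint)
  have hc : inner ℂ (opCos X (opCos X a)) a = inner ℂ (opCos X a) (opCos X a) :=
    (isSelfAdjoint_opCos X).isSymmetric _ _
  have hs : inner ℂ (opSin X (opSin X a)) a = inner ℂ (opSin X a) (opSin X a) :=
    (isSelfAdjoint_opSin X).isSymmetric _ _
  have h2 := congrArg (inner ℂ · a) h1
  simp only [inner_add_left] at h2
  rw [hc, hs, inner_self_eq_norm_sq_to_K, inner_self_eq_norm_sq_to_K,
    inner_self_eq_norm_sq_to_K, add_comm] at h2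
  exact_mod_cast h2

/-- `Q(a, 0) = (C(Ca), S(Ca))`, and `C² + S² = 1` applied to `Ca`. -/
theorem norm_apply_right_inclLeft (h : IsHalmosDecomposition P Q V X) (a : L) :
    ‖Q (inclLeft V a)‖ = ‖opCos X a‖ := by
  have hcomm : opCos X (opSin X a) = opSin X (opCos X a) := congrArg (· a) (opCos_opSin_commute X)
  rw [inclLeft_apply, h.apply_right, show ∀ w, ‖((V.symm w : genericPart P Q) : H)‖ = ‖V.symm w‖ from fun _ => rfl, V.symm.norm_map,
    ← sq_eq_sq₀ (norm_nonneg _) (norm_nonneg _), WithLp.prod_norm_sq_eq_of_L2]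
  simp only [map_zero, add_zero, hcomm]
  exact h.norm_opCos_sq_add_norm_opSin_sq _

theorem mul_apply_symm (h : IsHalmosDecomposition P Q V X) (a c : L) :
    (Q * P) (V.symm (WithLp.toLp 2 (a, c)) : H) = Q (inclLeft V a) :=
  congrArg Q (h.apply_left a c)

theorem enorm_mul_apply_symm (h : IsHalmosDecomposition P Q V X) (a c : L) :
    ‖(Q * P) (V.symm (WithLp.toLp 2 (a, c)) : H)‖ₑ = ‖opCos X a‖ₑ := by
  rw [h.mul_apply_symm, enorm_eq_iff_norm_eq, h.norm_apply_right_inclLeft]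

/-- `QP` kills the complement of the generic part and the second copy of `L`, so its norm may be
summed along a basis of the first copy. -/
theorem hsNorm_opCos_sq (hP : P * P = P) (hQ : Q * Q = Q) (h : IsHalmosDecomposition P Q V X)
    (hPQ : ∀ x, P x = x → Q x = x → x = 0) : hsNorm (opCos X) ^ 2 = hsNorm (Q * P) ^ 2 := by
  obtain ⟨w, b, -⟩ := exists_hilbertBasis ℂ L
  rw [hsNorm_sq b, ← tsum_enorm_sq_comp_isometry b (inclLeft V) (Q * P)]
  · exact tsum_congr fun i => by rw [inclLeft_apply, h.enorm_mul_apply_symm]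
  · intro y hy
    obtain ⟨g, hg, z, hz, rfl⟩ := (genericPart P Q).exists_add_mem_mem_orthogonal y
    rw [map_add, mul_apply_eq_zero_of_mem_orthogonal_genericPart hP hQ hPQ hz, add_zero]
    obtain ⟨⟨a, c⟩, hac⟩ := V.symm.surjective ⟨g, hg⟩
    have hg' : (V.symm (WithLp.toLp 2 (a, c)) : H) = g := congrArg Subtype.val hac
    have ha : a = 0 := by
      have h1 := hy a
      have h0 : inner ℂ (inclLeft V a) z = 0 := Submodule.inner_right_of_mem_orthogonal
        (Submodule.coe_mem (V.symm (WithLp.toLp 2 (a, 0)))) hz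
      rw [inner_add_right, h0, add_zero, ← hg'] at h1
      have h2 : inner ℂ (V.symm (WithLp.toLp 2 (a, 0))) (V.symm (WithLp.toLp 2 (a, c))) = 0 := h1
      rw [V.symm.inner_map_map, WithLp.prod_inner_apply] at h2
      simpa using h2
    rw [← hg', h.mul_apply_symm, ha, map_zero, map_zero]

theorem exists_isEigenbasis {L : Type} [NormedAddCommGroup L] [InnerProductSpace ℂ L]
    [CompleteSpace L] {V : genericPart P Q ≃ₗᵢ[ℂ] WithLp 2 (L × L)} {X : L →L[ℂ] L}
    (h : IsHalmosDecomposition P Q V X) (hc : IsCompactOperator (opCos X)) :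
    ∃ (ι : Type) (b : HilbertBasis ι ℂ L) (γ : ι → ℝ), IsEigenbasis X b γ := by
  refine _root_.exists_isEigenbasis h.isSelfAdjoint fun x hx => ?_
  refine hc.eq_zero_of_inner_eigenvector (isSelfAdjoint_opCos X) fun μ v hv =>
    hx (Real.arccos μ) v ?_
  have h1 := cfc_apply_eigenvector (isSelfAdjoint_opCos X) hv Real.continuous_arccos
  rwa [h.cfc_arccos_cos] at h1

theorem tsum_half_cos_sq (hP : P * P = P) (hQ : Q * Q = Q) (h : IsHalmosDecomposition P Q V X)
    (hPQ : ∀ x, P x = x → Q x = x → x = 0) {ι : Type*}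
    {b : HilbertBasis ι ℂ (WithLp 2 (L × L))} {μ : ι → ℝ}
    (hb : IsEigenbasis (codiagonalBlock X) b μ) :
    ∑' i, ENNReal.ofReal (1 / 2 * Real.cos (μ i) ^ 2) = hsNorm (Q * P) ^ 2 := by
  rw [← tsum_enorm_sq_comp_isometry b
    ((genericPart P Q).subtypeₗᵢ.comp V.symm.toLinearIsometry) (Q * P)]
  · refine tsum_congr fun i => ?_
    obtain ⟨a, c, hac⟩ : ∃ a c, b i = WithLp.toLp 2 (a, c) := ⟨(b i).fst, (b i).snd, rfl⟩
    have hbi := hb i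
    have hnorm : ‖a‖ ^ 2 + ‖c‖ ^ 2 = 1 := by
      have h1 := WithLp.prod_norm_sq_eq_of_L2 (b i)
      rw [b.orthonormal.1 i, hac] at h1
      simpa using h1.symm
    rw [hac] at hbi
    -- This is where `N(X) = {0}` enters: `‖a‖ = ‖c‖` is available only for nonzero eigenvalues.
    have hμ : μ i ≠ 0 := by
      intro h0
      rw [h0, Complex.ofReal_zero, zero_smul, codiagonalBlock_toLp, WithLp.toLp_eq_zero,
        Prod.mk_eq_zero, neg_eq_zero, smul_eq_zero, smul_eq_zero] at hbi
      have hker : ∀ x, X x = 0 → x = 0 := fun x hx =>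
        (Submodule.mem_bot ℂ).mp (h.ker_eq_bot ▸ LinearMap.mem_ker.mpr hx)
      rw [hker a (hbi.2.resolve_left Complex.I_ne_zero),
        hker c (hbi.1.resolve_left Complex.I_ne_zero)] at hnorm
      simp at hnorm
    obtain ⟨h1, h2⟩ := apply_eq_abs_smul_of_codiagonalBlock h.nonneg hμ hbi
    have h3 : ‖a‖ ^ 2 = 1 / 2 := by
      rw [h2] at hnorm; linarith
    change _ = ‖(Q * P) (V.symm (b i) : H)‖ₑ ^ 2
    rw [hac, h.enorm_mul_apply_symm, opCos,
      cfc_apply_eigenvector h.isSelfAdjoint h1 Real.continuous_cos, enorm_ofReal_smul_sq, h3,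
      Real.cos_abs, mul_comm]
  · intro y hy
    refine mul_apply_eq_zero_of_mem_orthogonal_genericPart hP hQ hPQ ?_
    rw [Submodule.mem_orthogonal]
    intro u hu
    have h1 := hy (V ⟨u, hu⟩)
    simpa using h1

end IsHalmosDecomposition

/-! ### The geodesic exponent built from a Halmos decomposition -/

namespace IsHalmosDecomposition

variable {H : Type*} [NormedAddCommGroup H] [InnerProductSpace ℂ H] [CompleteSpace H]
variable {P Q : H →L[ℂ] H}

section General

variable {L : Type*} [NormedAddCommGroup L] [InnerProductSpace ℂ L] [CompleteSpace L]
variable {V : genericPart P Q ≃ₗᵢ[ℂ] WithLp 2 (L × L)} {X : L →L[ℂ] L}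

/-- The identification of `L × L` with the generic part, as an isometry into the whole space. -/
def inclGeneric (V : genericPart P Q ≃ₗᵢ[ℂ] WithLp 2 (L × L)) : WithLp 2 (L × L) →ₗᵢ[ℂ] H :=
  (genericPart P Q).subtypeₗᵢ.comp V.symm.toLinearIsometry

theorem inclGeneric_apply (V : genericPart P Q ≃ₗᵢ[ℂ] WithLp 2 (L × L)) (w : WithLp 2 (L × L)) :
    inclGeneric V w = (V.symm w : H) := rfl

theorem adjoint_inclGeneric_apply (V : genericPart P Q ≃ₗᵢ[ℂ] WithLp 2 (L × L)) {z : H}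
    (hz : z ∈ (genericPart P Q)ᗮ) :
    ContinuousLinearMap.adjoint (inclGeneric V).toContinuousLinearMap z = 0 := by
  refine ext_inner_left ℂ fun w => ?_
  rw [ContinuousLinearMap.adjoint_inner_right, inner_zero_right]
  exact Submodule.inner_right_of_mem_orthogonal (Submodule.coe_mem (V.symm w)) hz

theorem exists_eq_inclGeneric_add (V : genericPart P Q ≃ₗᵢ[ℂ] WithLp 2 (L × L)) (y : H) :
    ∃ w, ∃ z ∈ (genericPart P Q)ᗮ, y = inclGeneric V w + z := by
  obtain ⟨g, hg, z, hz, rfl⟩ := (genericPart P Q).exists_add_mem_mem_orthogonal y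
  obtain ⟨w, hw⟩ := V.symm.surjective ⟨g, hg⟩
  exact ⟨w, z, hz, by rw [inclGeneric_apply, hw]⟩

/-- The operator that vanishes on the orthogonal complement of the generic part and is
`(0 iX; -iX 0)` on the generic part. -/
def exponent (V : genericPart P Q ≃ₗᵢ[ℂ] WithLp 2 (L × L)) (X : L →L[ℂ] L) : H →L[ℂ] H :=
  -((inclGeneric V).toContinuousLinearMap ∘L codiagonalBlock X ∘L
    ContinuousLinearMap.adjoint (inclGeneric V).toContinuousLinearMap)

theorem isSelfAdjoint_exponent (h : IsHalmosDecomposition P Q V X) :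
    IsSelfAdjoint (exponent V X) :=
  ((isSelfAdjoint_codiagonalBlock h.isSelfAdjoint).conj_adjoint _).neg

theorem exponent_apply_inclGeneric (V : genericPart P Q ≃ₗᵢ[ℂ] WithLp 2 (L × L)) (X : L →L[ℂ] L)
    (w : WithLp 2 (L × L)) :
    exponent V X (inclGeneric V w) = -inclGeneric V (codiagonalBlock X w) := by
  change -inclGeneric V (codiagonalBlock X (ContinuousLinearMap.adjoint
    (inclGeneric V).toContinuousLinearMap (inclGeneric V w))) = _
  rw [LinearIsometry.adjoint_apply_self]

theorem exponent_apply_of_mem_orthogonal (V : genericPart P Q ≃ₗᵢ[ℂ] WithLp 2 (L × L))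
    (X : L →L[ℂ] L) {z : H} (hz : z ∈ (genericPart P Q)ᗮ) : exponent V X z = 0 := by
  change -inclGeneric V (codiagonalBlock X (ContinuousLinearMap.adjoint
    (inclGeneric V).toContinuousLinearMap z)) = _
  rw [adjoint_inclGeneric_apply V hz, map_zero, map_zero, neg_zero]

theorem apply_left_inclGeneric (h : IsHalmosDecomposition P Q V X) (a c : L) :
    P (inclGeneric V (WithLp.toLp 2 (a, c))) = inclGeneric V (WithLp.toLp 2 (a, 0)) :=
  h.apply_left a c

theorem isCodiagonal_exponent (hP : P * P = P) (h : IsHalmosDecomposition P Q V X)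
    (hPz : ∀ z ∈ (genericPart P Q)ᗮ, P z = 0) : IsCodiagonal P (exponent V X) := by
  refine isCodiagonal_of_add_eq hP ?_
  ext y
  obtain ⟨⟨a, c⟩, z, hz, rfl⟩ := exists_eq_inclGeneric_add V y
  change P (exponent V X (inclGeneric V (WithLp.toLp 2 (a, c)) + z)) +
    exponent V X (P (inclGeneric V (WithLp.toLp 2 (a, c)) + z)) =
    exponent V X (inclGeneric V (WithLp.toLp 2 (a, c)) + z)
  simp only [map_add, hPz z hz, exponent_apply_of_mem_orthogonal V X hz, add_zero,
    h.apply_left_inclGeneric, exponent_apply_inclGeneric, codiagonalBlock_toLp, map_neg]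
  rw [← neg_add, ← map_add, ← WithLp.toLp_add]
  simp

theorem norm_le_pi_div_two (h : IsHalmosDecomposition P Q V X) : ‖X‖ ≤ Real.pi / 2 := by
  rw [CStarAlgebra.norm_le_iff_le_algebraMap X (by positivity) h.nonneg,
    Algebra.algebraMap_eq_smul_one]
  exact h.le_pi_div_two

theorem norm_exponent_le (h : IsHalmosDecomposition P Q V X) :
    ‖exponent V X‖ ≤ Real.pi / 2 := by
  refine ContinuousLinearMap.opNorm_le_bound _ (by positivity) fun y => ?_
  obtain ⟨⟨a, c⟩, z, hz, rfl⟩ := exists_eq_inclGeneric_add V y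
  rw [map_add, exponent_apply_of_mem_orthogonal V X hz, add_zero, exponent_apply_inclGeneric,
    norm_neg, LinearIsometry.norm_map]
  have h1 : ‖codiagonalBlock X (WithLp.toLp 2 (a, c))‖ ≤
      Real.pi / 2 * ‖WithLp.toLp 2 (a, c)‖ := by
    rw [← sq_le_sq₀ (norm_nonneg _) (by positivity), mul_pow, codiagonalBlock_toLp,
      WithLp.prod_norm_sq_eq_of_L2, WithLp.prod_norm_sq_eq_of_L2]
    have h2 : ∀ x, ‖X x‖ ^ 2 ≤ (Real.pi / 2) ^ 2 * ‖x‖ ^ 2 := fun x => by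
      rw [← mul_pow]
      exact pow_le_pow_left₀ (norm_nonneg _) (X.le_of_opNorm_le h.norm_le_pi_div_two x) 2
    change ‖-(Complex.I • X c)‖ ^ 2 + ‖Complex.I • X a‖ ^ 2 ≤
      (Real.pi / 2) ^ 2 * (‖a‖ ^ 2 + ‖c‖ ^ 2)
    rw [norm_neg, norm_smul, norm_smul, Complex.norm_I, one_mul, one_mul]
    linarith [h2 a, h2 c]
  refine h1.trans (mul_le_mul_of_nonneg_left ?_ (by positivity))
  have h3 : inner ℂ (inclGeneric V (WithLp.toLp 2 (a, c))) z = 0 :=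
    Submodule.inner_right_of_mem_orthogonal (Submodule.coe_mem (V.symm (WithLp.toLp 2 (a, c)))) hz
  have h4 := norm_add_sq_eq_norm_sq_add_norm_sq_of_inner_eq_zero _ _ h3
  rw [LinearIsometry.norm_map] at h4
  refine abs_le_of_sq_le_sq' ?_ (norm_nonneg _) |>.2
  rw [pow_two, pow_two]
  exact h4.symm ▸ le_add_of_nonneg_right (mul_self_nonneg _)

/-- It reduces an operator identity on `L × L` to vectors `(a, ±ia)` with `a` an eigenvector of `X`.
For `μ = 0` the vector is zero and the sign is arbitrary. -/
theorem exists_sign_of_codiagonalBlock (h : IsHalmosDecomposition P Q V X) {a c : L} {μ : ℝ}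
    (hμ : codiagonalBlock X (WithLp.toLp 2 (a, c)) = (μ : ℂ) • WithLp.toLp 2 (a, c)) :
    ∃ ε : ℝ, (ε = 1 ∨ ε = -1) ∧ X a = ((|μ| : ℝ) : ℂ) • a ∧ c = ((ε : ℂ) * Complex.I) • a := by
  have hker : ∀ x, X x = 0 → x = 0 := fun x hx =>
    (Submodule.mem_bot ℂ).mp (h.ker_eq_bot ▸ LinearMap.mem_ker.mpr hx)
  have hμ' := hμ
  rw [codiagonalBlock_toLp, ← WithLp.toLp_smul] at hμ'
  have hμ'' := Prod.mk.inj (WithLp.toLp_injective 2 hμ')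
  have h1 : -(Complex.I • X c) = (μ : ℂ) • a := hμ''.1
  have h2 : Complex.I • X a = (μ : ℂ) • c := hμ''.2
  rcases eq_or_ne μ 0 with rfl | h0
  · rw [Complex.ofReal_zero, zero_smul] at h1 h2
    have ha := hker a ((smul_eq_zero.mp h2).resolve_left Complex.I_ne_zero)
    have hc := hker c ((smul_eq_zero.mp (neg_eq_zero.mp h1)).resolve_left Complex.I_ne_zero)
    exact ⟨1, .inl rfl, by simp [ha], by simp [ha, hc]⟩
  · have hXa := (apply_eq_abs_smul_of_codiagonalBlock h.nonneg h0 hμ).1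
    have hε : |μ| / μ = 1 ∨ |μ| / μ = -1 := by
      rcases abs_choice μ with h3 | h3 <;> rw [h3]
      · exact .inl (div_self h0)
      · exact .inr (by rw [neg_div, div_self h0])
    refine ⟨|μ| / μ, hε, hXa, ?_⟩
    have h0' : (μ : ℂ) ≠ 0 := Complex.ofReal_ne_zero.mpr h0
    refine smul_right_injective L h0' ?_
    change (μ : ℂ) • c = (μ : ℂ) • _
    rw [← h2, hXa, smul_smul, smul_smul]
    congr 1
    push_cast
    field_simp

/-- Both sides multiply the vector by `e^{-2iεγ}`: a product of two plane reflections is the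
rotation by twice the angle between their axes. -/
theorem exp_mul_exp_apply (h : IsHalmosDecomposition P Q V X) {a : L} {γ ε : ℝ}
    (ha : X a = (γ : ℂ) • a) (hε : ε = 1 ∨ ε = -1) :
    (NormedSpace.exp (Complex.I • exponent V X) * NormedSpace.exp (Complex.I • exponent V X))
        (inclGeneric V (WithLp.toLp 2 (a, ((ε : ℂ) * Complex.I) • a))) =
      ((2 * Q - 1) * (2 * P - 1))
        (inclGeneric V (WithLp.toLp 2 (a, ((ε : ℂ) * Complex.I) • a))) := by
  have hε2 : ε * ε = 1 := by rcases hε with rfl | rfl <;> norm_num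
  have hε' : (ε : ℂ) * ε = 1 := by exact_mod_cast hε2
  set y := inclGeneric V (WithLp.toLp 2 (a, ((ε : ℂ) * Complex.I) • a)) with hy
  have hYy : exponent V X y = ((-(ε * γ) : ℝ) : ℂ) • y := by
    rw [hy, exponent_apply_inclGeneric, codiagonalBlock_eigenvector ha hε2, map_smul,
      Complex.ofReal_neg, neg_smul]
  have hE := exp_I_smul_apply_eigenvector h.isSelfAdjoint_exponent hYy
  have hexp : Complex.exp (((-(ε * γ) : ℝ) : ℂ) * Complex.I) =
      (Real.cos γ : ℂ) - ε * Real.sin γ * Complex.I := by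
    rw [Complex.exp_mul_I, ← Complex.ofReal_cos, ← Complex.ofReal_sin]
    rcases hε with rfl | rfl <;> simp [sub_eq_add_neg]
  have hcs : (Real.cos γ : ℂ) * Real.cos γ + Real.sin γ * Real.sin γ = 1 := by
    have := Real.cos_sq_add_sin_sq γ
    rw [pow_two, pow_two] at this
    exact_mod_cast this
  have hC : opCos X a = (Real.cos γ : ℂ) • a :=
    cfc_apply_eigenvector h.isSelfAdjoint ha Real.continuous_cos
  have hS : opSin X a = (Real.sin γ : ℂ) • a :=
    cfc_apply_eigenvector h.isSelfAdjoint ha Real.continuous_sin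
  have hPy : P y = inclGeneric V (WithLp.toLp 2 (a, 0)) := h.apply_left_inclGeneric _ _
  have hPy' : (2 * P - 1) y = inclGeneric V (WithLp.toLp 2 (a, -(((ε : ℂ) * Complex.I) • a))) := by
    change (2 : ℕ) • P y - y = _
    rw [hPy, hy, ← map_nsmul, ← map_sub, ← WithLp.toLp_smul, ← WithLp.toLp_sub]
    congr 2
    ext <;> simp [two_smul]
  change NormedSpace.exp (Complex.I • exponent V X)
    (NormedSpace.exp (Complex.I • exponent V X) y) = (2 * Q - 1) ((2 * P - 1) y)
  rw [hE, map_smul, hE, hexp, smul_smul, hPy']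
  change _ = (2 : ℕ) • Q (inclGeneric V _) - inclGeneric V _
  rw [inclGeneric_apply V (WithLp.toLp 2 (a, -(((ε : ℂ) * Complex.I) • a))), h.apply_right,
    ← inclGeneric_apply, ← inclGeneric_apply, ← map_nsmul, ← map_sub, hy, ← map_smul,
    ← WithLp.toLp_smul, ← WithLp.toLp_smul, ← WithLp.toLp_sub]
  congr 2
  simp only [map_neg, map_smul, hC, hS, Prod.smul_mk, Prod.mk_add_mk, Prod.mk_sub_mk, two_smul]
  -- What remains is polynomial algebra from `C² + S² = 1`, `i² = -1` and `ε² = 1`.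
  generalize (Real.cos γ : ℂ) = C at hcs ⊢
  generalize (Real.sin γ : ℂ) = S at hcs ⊢
  refine Prod.ext ?_ ?_
  · change _ • a = _
    match_scalars
    linear_combination (-1 : ℂ) * hcs + (ε * ε * S * S) * Complex.I_mul_I - S * S * hε'
  · change _ • (_ • a) = _
    match_scalars
    linear_combination (ε * Complex.I) * hcs +
      (ε * Complex.I * S * S - 2 * C * S) * (ε * ε * Complex.I_mul_I - hε')

/-- On the generic part an eigenbasis suffices. On its complement `P`, `Q` and the exponent vanish,
and both sides are the identity. -/
theorem exp_mul_exp_eq {L : Type} [NormedAddCommGroup L] [InnerProductSpace ℂ L]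
    [CompleteSpace L] {V : genericPart P Q ≃ₗᵢ[ℂ] WithLp 2 (L × L)} {X : L →L[ℂ] L}
    (h : IsHalmosDecomposition P Q V X) (hc : IsCompactOperator (opCos X))
    (hPz : ∀ z ∈ (genericPart P Q)ᗮ, P z = 0) (hQz : ∀ z ∈ (genericPart P Q)ᗮ, Q z = 0) :
    NormedSpace.exp (Complex.I • exponent V X) * NormedSpace.exp (Complex.I • exponent V X) =
      (2 * Q - 1) * (2 * P - 1) := by
  obtain ⟨ι, b, γ, hb⟩ := h.exists_isEigenbasis hc
  obtain ⟨κ, c, μ, hcμ⟩ := exists_isEigenbasis_codiagonalBlock h.isSelfAdjoint hb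
  set E := NormedSpace.exp (Complex.I • exponent V X) with hE
  have h1 : (E * E) ∘L (inclGeneric V).toContinuousLinearMap =
      ((2 * Q - 1) * (2 * P - 1)) ∘L (inclGeneric V).toContinuousLinearMap := by
    refine ext_hilbertBasis c fun i => ?_
    obtain ⟨a, d, had⟩ : ∃ a d, c i = WithLp.toLp 2 (a, d) := ⟨(c i).fst, (c i).snd, rfl⟩
    have hci := hcμ i
    rw [had] at hci ⊢
    obtain ⟨ε, hε, hXa, rfl⟩ := h.exists_sign_of_codiagonalBlock hci
    exact h.exp_mul_exp_apply hXa hε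
  ext y
  obtain ⟨w, z, hz, rfl⟩ := exists_eq_inclGeneric_add V y
  have h2 : exponent V X z = ((0 : ℝ) : ℂ) • z := by
    rw [exponent_apply_of_mem_orthogonal V X hz, Complex.ofReal_zero, zero_smul]
  have h3 : E z = z := by
    rw [hE, exp_I_smul_apply_eigenvector h.isSelfAdjoint_exponent h2]
    simp
  have h4 : (2 * P - 1) z = -z := by
    change (2 : ℕ) • P z - z = _
    rw [hPz z hz, smul_zero, zero_sub]
  have h5 : (2 * Q - 1) z = -z := by
    change (2 : ℕ) • Q z - z = _
    rw [hQz z hz, smul_zero, zero_sub]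
  rw [map_add, map_add]
  congr 1
  · exact congrArg (· w) h1
  · change E (E z) = (2 * Q - 1) ((2 * P - 1) z)
    rw [h3, h3, h4, map_neg, h5, neg_neg]

end General

/-- If the norm were `r < π/2`, every `cos²γ` would be at least `cos²r > 0`; the finite sum would
leave finitely many `γ`, making `L`, and with it `R(P)`, finite-dimensional. -/
theorem pi_div_two_le_norm_exponent {L : Type} [NormedAddCommGroup L] [InnerProductSpace ℂ L]
    [CompleteSpace L] {V : genericPart P Q ≃ₗᵢ[ℂ] WithLp 2 (L × L)} {X : L →L[ℂ] L}
    (h : IsHalmosDecomposition P Q V X) (hc : hsNorm (opCos X) ≠ ∞)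
    (hPz : ∀ z ∈ (genericPart P Q)ᗮ, P z = 0)
    (hinf : ¬ FiniteDimensional ℂ (LinearMap.range P.toLinearMap)) :
    Real.pi / 2 ≤ ‖exponent V X‖ := by
  by_contra! hlt
  obtain ⟨ι, b, γ, hb⟩ := h.exists_isEigenbasis (isCompactOperator_of_hsNorm_ne_top _ hc)
  set r := ‖exponent V X‖ with hr
  have hr0 : 0 ≤ r := norm_nonneg _
  have hcos : 0 < Real.cos r := Real.cos_pos_of_mem_Ioo ⟨by linarith [Real.pi_pos], hlt⟩
  have hγ : ∀ i, |γ i| ≤ r := by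
    intro i
    set y := inclGeneric V (WithLp.toLp 2 (b i, (((1 : ℝ) : ℂ) * Complex.I) • b i)) with hy
    have h1 : exponent V X y = -(((1 * γ i : ℝ) : ℂ) • y) := by
      rw [hy, exponent_apply_inclGeneric, codiagonalBlock_eigenvector (hb i) (by norm_num),
        map_smul]
    have hy0 : 0 < ‖y‖ := by
      rw [norm_pos_iff, hy, (map_ne_zero_iff _ (inclGeneric V).injective)]
      intro h0
      have h2 : b i = 0 := congrArg WithLp.fst h0
      exact b.orthonormal.ne_zero i h2
    have h3 := (exponent V X).le_opNorm y
    rw [h1, norm_neg, norm_smul, Complex.norm_real, one_mul, Real.norm_eq_abs] at h3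
    exact le_of_mul_le_mul_right h3 hy0
  have hsum : ∑' i, ENNReal.ofReal (Real.cos (γ i) ^ 2) ≠ ∞ := by
    rw [← hb.hsNorm_opCos_sq h.isSelfAdjoint]
    exact ENNReal.pow_ne_top hc
  have hfin := ENNReal.finite_const_le_of_tsum_ne_top hsum
    (ENNReal.ofReal_pos.mpr (pow_pos hcos 2)).ne'
  have huniv : {i | ENNReal.ofReal (Real.cos r ^ 2) ≤ ENNReal.ofReal (Real.cos (γ i) ^ 2)} =
      Set.univ := by
    refine Set.eq_univ_of_forall fun i => ENNReal.ofReal_le_ofReal ?_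
    rw [← Real.cos_abs (γ i)]
    exact pow_le_pow_left₀ hcos.le (Real.cos_le_cos_of_nonneg_of_le_pi (abs_nonneg _)
      (by linarith [Real.pi_pos]) (hγ i)) 2
  rw [huniv] at hfin
  have : Finite ι := Set.finite_univ_iff.mp hfin
  have := Fintype.ofFinite ι
  have : FiniteDimensional ℂ L := Module.Finite.of_basis b.toOrthonormalBasis.toBasis
  refine hinf (Submodule.finiteDimensional_of_le (S₂ := LinearMap.range (inclLeft V).toLinearMap) ?_)
  rintro - ⟨x, rfl⟩
  obtain ⟨⟨a, c⟩, z, hz, rfl⟩ := exists_eq_inclGeneric_add V x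
  refine ⟨a, ?_⟩
  change inclLeft V a = P (inclGeneric V (WithLp.toLp 2 (a, c)) + z)
  rw [map_add, hPz z hz, add_zero, h.apply_left_inclGeneric]
  rfl

theorem isGeodesicExponent_exponent {L : Type} [NormedAddCommGroup L] [InnerProductSpace ℂ L]
    [CompleteSpace L] {V : genericPart P Q ≃ₗᵢ[ℂ] WithLp 2 (L × L)} {X : L →L[ℂ] L}
    (hP : P * P = P) (hQ : Q * Q = Q)
    (h : IsHalmosDecomposition P Q V X) (hs : hsNorm (Q * P) ≠ ∞)
    (hPQ : ∀ x, P x = x → Q x = x → x = 0) (h1 : ∀ x, P x = x → Q x = 0 → x = 0)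
    (h2 : ∀ x, Q x = x → P x = 0 → x = 0)
    (hinf : ¬ FiniteDimensional ℂ (LinearMap.range P.toLinearMap)) :
    IsGeodesicExponent P Q (exponent V X) := by
  -- With the other three intersections trivial, the complement of the generic part is `N(P) ∩
  -- N(Q)`.
  have hPz : ∀ z ∈ (genericPart P Q)ᗮ, P z = 0 := fun z hz =>
    apply_eq_zero_of_mem_orthogonal_genericPart hP hQ
      (fun y hy hy' => by rw [hPQ y hy hy', map_zero]) (fun y hy _ => hy)
      (fun y hy hy' => by rw [h1 y hy hy', map_zero]) (fun y hy _ => hy) hz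
  have hQz : ∀ z ∈ (genericPart P Q)ᗮ, Q z = 0 := fun z hz =>
    apply_eq_zero_of_mem_orthogonal_genericPart hP hQ
      (fun y hy hy' => by rw [hPQ y hy hy', map_zero]) (fun y _ hy => hy)
      (fun y _ hy => hy) (fun y hy hy' => by rw [h2 y hy' hy, map_zero]) hz
  have hcos : hsNorm (opCos X) ≠ ∞ := by
    intro h0
    have h3 := h.hsNorm_opCos_sq hP hQ hPQ
    rw [h0] at h3
    exact ENNReal.pow_ne_top hs (h3.symm.trans (by simp))
  have hcod := h.isCodiagonal_exponent hP hPz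
  have hsq := h.exp_mul_exp_eq (isCompactOperator_of_hsNorm_ne_top _ hcos) hPz hQz
  have hsymm := symmetry_mul_exp_neg hP hcod
  have hE := exp_I_smul_mul_exp_neg (exponent V X)
  have hcomm : Commute (exponent V X) (NormedSpace.exp (Complex.I • exponent V X)) := by
    let : NormedAlgebra ℚ (H →L[ℂ] H) := NormedAlgebra.restrictScalars ℚ ℂ _
    exact ((Commute.refl _).smul_right Complex.I).exp_right
  have hconj : NormedSpace.exp (Complex.I • exponent V X) * P *
      NormedSpace.exp (-(Complex.I • exponent V X)) = Q := by
    have hPP : (2 * P - 1) * (2 * P - 1) = 1 := by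
      have : (2 * P - 1) * (2 * P - 1) = 4 * (P * P) - 4 * P + 1 := by noncomm_ring
      rw [this, hP, sub_self, zero_add]
    generalize NormedSpace.exp (Complex.I • exponent V X) = E at *
    generalize NormedSpace.exp (-(Complex.I • exponent V X)) = E' at *
    -- `e^{iY}(2P - 1)e^{-iY} = e^{2iY}(2P - 1)`, and `(2P - 1)² = 1`.
    have h3 : E * (2 * P - 1) * E' = 2 * Q - 1 := by
      rw [mul_assoc, hsymm, ← mul_assoc, hsq, mul_assoc, hPP, mul_one]
    have h4 : E * (2 * P - 1) * E' = 2 * (E * P * E') - E * E' := by noncomm_ring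
    rw [h4, hE] at h3
    refine smul_right_injective _ (two_ne_zero' ℂ) ?_
    change (2 : ℂ) • _ = (2 : ℂ) • _
    rw [two_smul, two_smul, ← two_mul, ← two_mul]
    exact sub_left_injective h3
  refine ⟨h.isSelfAdjoint_exponent, le_antisymm h.norm_exponent_le
    (h.pi_div_two_le_norm_exponent hcos hPz hinf), hcod, ?_, hconj⟩
  -- Co-diagonality for `Q` is that for `P` conjugated by `e^{iY}`, which commutes with `Y`.
  refine isCodiagonal_of_add_eq hQ ?_
  have hE' := exp_neg_mul_exp_I_smul (exponent V X)
  have hadd := hcod.add_eq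
  generalize exponent V X = Y at *
  generalize NormedSpace.exp (Complex.I • Y) = E at *
  generalize NormedSpace.exp (-(Complex.I • Y)) = E' at *
  have hcomm' : E' * Y = Y * E' := by
    calc E' * Y = E' * (Y * E) * E' := by rw [mul_assoc, mul_assoc, hE, mul_one]
      _ = Y * E' := by rw [hcomm.eq, ← mul_assoc, hE', one_mul]
  calc Q * Y + Y * Q = E * P * (E' * Y) + Y * E * P * E' := by rw [← hconj]; noncomm_ring
    _ = E * (P * Y + Y * P) * E' := by rw [hcomm', hcomm.eq]; noncomm_ring
    _ = Y := by rw [hadd, ← hcomm.eq, mul_assoc, hE, mul_one]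

end IsHalmosDecomposition

end

theorem mainTheorem6 (n : ℕ) (hn : 0 < n) (I J : Set (Rn n))
    (hI : NullMeasurableSet I volume) (hJ : NullMeasurableSet J volume)
    (hI_pos : volume I ≠ 0) (hI_fin : volume I ≠ ∞)
    (hJ_pos : volume J ≠ 0) (hJ_fin : volume J ≠ ∞) :
    -- the generic part of `(P_I, Q_J)` has a Halmos decomposition
    (∃ (L : Type) (_ : NormedAddCommGroup L) (_ : InnerProductSpace ℂ L) (_ : CompleteSpace L)
      (V : genericPart (projP I hI) (projQ J hJ) ≃ₗᵢ[ℂ] WithLp 2 (L × L)) (X : L →L[ℂ] L),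
      IsHalmosDecomposition (projP I hI) (projQ J hJ) V X) ∧
    -- the formula in terms of any Halmos decomposition
    (∀ (L : Type) [NormedAddCommGroup L] [InnerProductSpace ℂ L] [CompleteSpace L]
      (V : genericPart (projP I hI) (projQ J hJ) ≃ₗᵢ[ℂ] WithLp 2 (L × L)) (X : L →L[ℂ] L),
      IsHalmosDecomposition (projP I hI) (projQ J hJ) V X →
        volume I ^ (1 / 2 : ℝ) * volume J ^ (1 / 2 : ℝ) = hsNorm (opCos X) ∧
        volume I ^ (1 / 2 : ℝ) * volume J ^ (1 / 2 : ℝ) =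
          ENNReal.ofReal (1 / √2) * hsNorm (opCos (codiagonalBlock X)) ∧
        EigenvalueSumEq X (fun γ => Real.cos γ ^ 2) (volume I * volume J) ∧
        EigenvalueSumEq (codiagonalBlock X) (fun γ => 1 / 2 * Real.cos γ ^ 2)
          (volume I * volume J)) ∧
    -- existence and uniqueness of the geodesic exponent `X_{I,J}`
    (LinearMap.range (projP I hI).toLinearMap ⊓ LinearMap.ker (projQ J hJ).toLinearMap = ⊥ →
      LinearMap.range (projQ J hJ).toLinearMap ⊓ LinearMap.ker (projP I hI).toLinearMap = ⊥ →
      ∃! Y : L2Rn n →L[ℂ] L2Rn n, IsGeodesicExponent (projP I hI) (projQ J hJ) Y) ∧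
    -- the formula in terms of the restriction of the geodesic exponent to `N(X_{I,J})ᗮ`
    (∀ (Y : L2Rn n →L[ℂ] L2Rn n) (hY : IsGeodesicExponent (projP I hI) (projQ J hJ) Y),
      volume I ^ (1 / 2 : ℝ) * volume J ^ (1 / 2 : ℝ) =
        ENNReal.ofReal (1 / √2) * hsNorm (opCos (restrictKerPerp Y hY.isSelfAdjoint)) ∧
      EigenvalueSumEq (restrictKerPerp Y hY.isSelfAdjoint) (fun γ => 1 / 2 * Real.cos γ ^ 2)
        (volume I * volume J)) := by 
  have hP := projP_mul_self I hI
  have hPs := isSelfAdjoint_projP I hI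
  have hQ := projQ_mul_self J hJ
  have hQs := isSelfAdjoint_projQ J hJ
  have hs := hsNorm_projQ_mul_projP_sq I J hI hJ hI_fin
  have hs_fin : volume I * volume J ≠ ∞ := ENNReal.mul_ne_top hI_fin hJ_fin
  have hPQ : ∀ x, projP I hI x = x → projQ J hJ x = x → x = 0 := fun x =>
    eq_zero_of_projP_eq_of_projQ_eq hn hI hJ hI_fin hJ_pos hJ_fin
  have hpow : volume I ^ (1 / 2 : ℝ) * volume J ^ (1 / 2 : ℝ) =
      (volume I * volume J) ^ (1 / 2 : ℝ) :=
    (ENNReal.mul_rpow_of_nonneg _ _ (by norm_num)).symm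
  obtain ⟨V, X, hVX⟩ := exists_isHalmosDecomposition hP hQ hPs hQs
  refine ⟨⟨genericRange (projP I hI) (projQ J hJ), inferInstance, inferInstance, inferInstance,
    V, X, hVX⟩, ?_, ?_, ?_⟩
  · intro L _ _ _ V X h
    have hcos : hsNorm (opCos X) ^ 2 = volume I * volume J :=
      (h.hsNorm_opCos_sq hP hQ hPQ).trans hs
    have hcos_fin : hsNorm (opCos X) ≠ ∞ := by
      rintro h0
      rw [h0] at hcos
      exact hs_fin (hcos.symm.trans (by simp))
    obtain ⟨ι, b, γ, hb⟩ := h.exists_isEigenbasis (isCompactOperator_of_hsNorm_ne_top _ hcos_fin)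
    have hblock : EigenvalueSumEq (codiagonalBlock X) (fun γ => 1 / 2 * Real.cos γ ^ 2)
        (volume I * volume J) :=
      ⟨exists_isEigenbasis_codiagonalBlock h.isSelfAdjoint hb,
        fun κ c μ hc => (h.tsum_half_cos_sq hP hQ hPQ hc).trans hs⟩
    refine ⟨hpow.trans (hsNorm_eq_rpow_of_sq_eq hcos).symm,
      hpow.trans (hblock.rpow_eq (isSelfAdjoint_codiagonalBlock h.isSelfAdjoint)),
      ⟨⟨ι, b, γ, hb⟩, fun κ c μ hc => ?_⟩, hblock⟩
    exact (hc.hsNorm_opCos_sq h.isSelfAdjoint).symm.trans hcos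
  · intro h1 h2
    have h1' : ∀ x, projP I hI x = x → projQ J hJ x = 0 → x = 0 := fun x hx hx' =>
      (Submodule.mem_bot ℂ).mp (h1 ▸ ⟨(mem_range_iff_of_mul_self hP).mpr hx, hx'⟩)
    have h2' : ∀ x, projQ J hJ x = x → projP I hI x = 0 → x = 0 := fun x hx hx' =>
      (Submodule.mem_bot ℂ).mp (h2 ▸ ⟨(mem_range_iff_of_mul_self hQ).mpr hx, hx'⟩)
    have hQP : hsNorm (projQ J hJ * projP I hI) ≠ ∞ := by
      intro h0
      rw [h0] at hs
      exact hs_fin (hs.symm.trans (by simp))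
    have hex := hVX.isGeodesicExponent_exponent hP hQ hQP hPQ h1' h2'
      (not_finiteDimensional_range_projP hn hI hI_pos hI_fin)
    exact ⟨_, hex, fun Z hZ => IsGeodesicExponent.unique hP hPs hQs h1' h2' hZ hex⟩
  · intro Y hY
    have hsum := hY.eigenvalueSumEq hP hPs hPQ hs hs_fin
    exact ⟨hpow.trans (hsum.rpow_eq (IsGeodesicExponent.isSelfAdjoint_restrictKerPerp
      hY.isSelfAdjoint)), hsum⟩
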